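/- **Corollary (Convergence of DP-Clipped-SGD for a non-convex objective).** Let $f(x)=\mathbb E_{\xi\sim\mathcal D}[f_\xi(x)]$ on $\mathbb R^d$. Fix $L,\Delta,\sigma,\lambda>0$, $\sigma_\omega\ge 0$, $\alpha\in(1,2]$, $\beta\in(0,1]$, an integer $K\ge 1$ and a starting point $x^0$. Let $$Q=\Big\{x\in\mathbb R^d:\ \exists\, y\in\mathbb R^d,\ f(y)\le f^*+2\Delta,\ \|x-y\|\le \tfrac{\sqrt\Delta}{20\sqrt L}\Big\},\qquad f^*=\inf_{x\in Q}f(x)>-\infty,\qquad f(x^0)-f^*\le\Delta .$$ Assume that for all $x,y\in Q$: $\|\nabla f(x)-\nabla f(y)\|\le L\|x-y\|$, $\ \mathbb E_\xi[\nabla f_\xi(x)]=\nabla f(x)$, and $\mathbb E_\xi\|\nabla f_\xi(x)-\nabla f(x)\|^\alpha\le\sigma^\alpha$. Consider the iterates $$x^{k+1}=x^k-\gamma\big(\min\{1,\lambda/\|\nabla f_{\xi^k}(x^k)\|\}\,\nabla f_{\xi^k}(x^k)+\omega_k\big),$$ where $\xi^0,\omega_0,\xi^1,\omega_1,\dots$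 are independent, $\xi^k\sim\mathcal D$ and $\omega_k\sim\mathcal N(0,\sigma_\omega^2 I_d)$. Put $$\zeta_\lambda=\max\{0,2\sqrt{L\Delta}-\tfrac\lambda2\},\quad S=\sigma^\alpha+\zeta_\lambda^\alpha,\quad B=\frac{\sqrt{L\Delta}}{\lambda}+\frac{\lambda^{\alpha-1}\zeta_\lambda}{S}+\sigma S^{-1/\alpha}.$$ Let $M>0$ and suppose that the clipping level satisfies $\lambda^\alpha\ln(K/\beta)\le M\,K\,S$. (For fixed parameters this holds for all sufficiently large $K$, and it holds whenever $\lambda\le M^{1/\alpha}\,\sigma\,(K/\ln(K/\beta))^{1/\alpha}$.) There is a constant $c_0>0$ depending only on $M$, and for each $c\in(0,c_0]$ a constant $C>0$ depending only on $M$ and $c$, such that if $$\gamma=c\cdot\min\left\{\frac1L,\ \frac{\sqrt{\Delta/L}}{\lambda^{1-\alpha/2}\sqrt{K S\ln(K/\beta)}},\ \frac{\sqrt{\Delta/L}\,\lambda^{\alpha-1}}{K S B},\ \frac{\sqrt{\Delta/L}}{\sigma_\omega\sqrt{dK\ln(K/\beta)}}\right\}$$ (a term with zero denominator is read as $+\infty$),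 then with probability at least $1-\beta$ $$\min_{0\le t\le K}\|\nabla f(x^t)\|^2\le C\,\max\{T_1,T_2,T_3,T_4\},$$ where $$T_1=\frac{L\Delta}{K}+\frac{L^2\Delta^2}{\lambda^2K^2},\qquad T_2=\sqrt{L\Delta}\,\lambda^{1-\alpha/2}\sqrt{\frac{S\ln(K/\beta)}{K}}+\frac{L\Delta\, S\ln(K/\beta)}{\lambda^\alpha K},$$ $$T_3=\frac{\sqrt{L\Delta}\,S B}{\lambda^{\alpha-1}}+\frac{L\Delta\,S^2B^2}{\lambda^{2\alpha}},\qquad T_4=\frac{\sigma_\omega\sqrt{dL\Delta\ln(K/\beta)}}{\sqrt K}+\frac{\sigma_\omega^2\,dL\Delta\ln(K/\beta)}{\lambda^2K}.$$ -/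

import Mathlib

open MeasureTheory ProbabilityTheory
open scoped Gradient ENNReal

noncomputable section

namespace DPClippedSGD

universe u

/-- The objective `f(x) = 𝔼_{ξ ∼ D} [f_ξ(x)]`, where `F ξ` is the loss `f_ξ` of the sample `ξ`. -/
def expectedLoss {d : ℕ} {Ξ : Type u} [MeasurableSpace Ξ] (D : Measure Ξ)
    (F : Ξ → EuclideanSpace ℝ (Fin d) → ℝ) (x : EuclideanSpace ℝ (Fin d)) : ℝ :=
  ∫ s, F s x ∂D

/-- The clipping operator `clip(v, lam) = min {1, lam / ‖v‖} v` (and `clip(0, lam) = 0`). -/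
def clip {d : ℕ} (lam : ℝ) (v : EuclideanSpace ℝ (Fin d)) : EuclideanSpace ℝ (Fin d) :=
  min 1 (lam / ‖v‖) • v

/-- The iterates `x^{k+1} = x^k - γ (clip(∇f_{ξ^k}(x^k), lam) + ω_k)` along the samples `ξ^k` and the
noise vectors `ω_k`. -/
def iterate {d : ℕ} {Ξ : Type u} (F : Ξ → EuclideanSpace ℝ (Fin d) → ℝ) (γ lam : ℝ)
    (x₀ : EuclideanSpace ℝ (Fin d)) (ξ : ℕ → Ξ) (w : ℕ → EuclideanSpace ℝ (Fin d)) :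
    ℕ → EuclideanSpace ℝ (Fin d)
  | 0 => x₀
  | k + 1 => iterate F γ lam x₀ ξ w k
      - γ • (clip lam (∇ (F (ξ k)) (iterate F γ lam x₀ ξ w k)) + w k)

/-- The set `Q` of points within `√Δ / (20 √L)` of the sublevel set `{f ≤ f* + 2Δ}`. -/
def region {d : ℕ} (f : EuclideanSpace ℝ (Fin d) → ℝ) (fstar L Δ : ℝ) :
    Set (EuclideanSpace ℝ (Fin d)) :=
  {x | ∃ y, f y ≤ fstar + 2 * Δ ∧ ‖x - y‖ ≤ √Δ / (20 * √L)}

/-- `f` is differentiable at the points of `Q` and `∇f` is `L`-Lipschitz on `Q`. -/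
structure SmoothOn {d : ℕ} (f : EuclideanSpace ℝ (Fin d) → ℝ) (L : ℝ)
    (Q : Set (EuclideanSpace ℝ (Fin d))) : Prop where
  differentiableAt : ∀ x ∈ Q, DifferentiableAt ℝ f x
  lipschitz : ∀ x ∈ Q, ∀ y ∈ Q, ‖∇ f x - ∇ f y‖ ≤ L * ‖x - y‖

/-- The expected loss and the stochastic gradients `∇f_ξ(x)` are well defined. -/
structure StochasticObjective {d : ℕ} {Ξ : Type u} [MeasurableSpace Ξ] (D : Measure Ξ)
    (F : Ξ → EuclideanSpace ℝ (Fin d) → ℝ) : Prop where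
  integrable : ∀ x, Integrable (fun s => F s x) D
  differentiable : ∀ s, Differentiable ℝ (F s)
  measurable_gradient :
    Measurable (fun p : Ξ × EuclideanSpace ℝ (Fin d) => ∇ (F p.1) p.2)

/-- On `Q` the stochastic gradient is unbiased, with central `α`-th moment at most `σ ^ α`. -/
structure HeavyTailedOracleOn {d : ℕ} {Ξ : Type u} [MeasurableSpace Ξ] (D : Measure Ξ)
    (F : Ξ → EuclideanSpace ℝ (Fin d) → ℝ) (α σ : ℝ)
    (Q : Set (EuclideanSpace ℝ (Fin d))) : Prop where
  integrable : ∀ x ∈ Q, Integrable (fun s => ∇ (F s) x) D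
  unbiased : ∀ x ∈ Q, ∫ s, ∇ (F s) x ∂D = ∇ (expectedLoss D F) x
  integrable_moment : ∀ x ∈ Q,
    Integrable (fun s => ‖∇ (F s) x - ∇ (expectedLoss D F) x‖ ^ α) D
  moment_le : ∀ x ∈ Q, ∫ s, ‖∇ (F s) x - ∇ (expectedLoss D F) x‖ ^ α ∂D ≤ σ ^ α

/-- `ζ = max {0, 2 √(LΔ) - lam / 2}`. -/
def zeta (L Δ lam : ℝ) : ℝ := max 0 (2 * √(L * Δ) - lam / 2)

/-- `σ ^ α + ζ ^ α`. -/
def noiseLevel (α σ L Δ lam : ℝ) : ℝ := σ ^ α + zeta L Δ lam ^ α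

/-- The factor
`√(LΔ) / lam + lam ^ (α - 1) ζ / (σ ^ α + ζ ^ α) + σ (σ ^ α + ζ ^ α) ^ (-1 / α)`. -/
def biasFactor (α σ L Δ lam : ℝ) : ℝ :=
  √(L * Δ) / lam + lam ^ (α - 1) * zeta L Δ lam / noiseLevel α σ L Δ lam
    + σ * noiseLevel α σ L Δ lam ^ (-1 / α)

/-- The minimum of the four terms of the step-size condition. The quotients are taken in `[0, ∞]`,
so that a term with denominator `0` (for instance when there is no DP noise) is `∞` and imposes no
restriction. The minimum is finite because of the term `1 / L`. -/
def stepsizeMin (d K : ℕ) (α σ σw L Δ lam β : ℝ) : ℝ :=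
  (min (ENNReal.ofReal (1 / L))
    (min (ENNReal.ofReal √(Δ / L) /
        ENNReal.ofReal (lam ^ (1 - α / 2)
          * √(K * Real.log (K / β) * noiseLevel α σ L Δ lam)))
    (min (ENNReal.ofReal (√(Δ / L) * lam ^ (α - 1)) /
        ENNReal.ofReal (K * noiseLevel α σ L Δ lam * biasFactor α σ L Δ lam))
      (ENNReal.ofReal √(Δ / L) /
        ENNReal.ofReal (σw * √(d * K * Real.log (K / β))))))).toReal

def optimizationTerm (K : ℕ) (L Δ lam : ℝ) : ℝ :=
  L * Δ / K + L ^ 2 * Δ ^ 2 / (lam ^ 2 * K ^ 2)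

def stochasticTerm (K : ℕ) (α σ L Δ lam β : ℝ) : ℝ :=
  √(L * Δ) * lam ^ (1 - α / 2) * √(noiseLevel α σ L Δ lam * Real.log (K / β) / K)
    + L * Δ * noiseLevel α σ L Δ lam * Real.log (K / β) / (lam ^ α * K)

def clippingBiasTerm (α σ L Δ lam : ℝ) : ℝ :=
  √(L * Δ) * noiseLevel α σ L Δ lam * biasFactor α σ L Δ lam / lam ^ (α - 1)
    + L * Δ * noiseLevel α σ L Δ lam ^ 2 * biasFactor α σ L Δ lam ^ 2 / lam ^ (2 * α)

def dpTerm (d K : ℕ) (σw L Δ lam β : ℝ) : ℝ :=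
  σw * √(d * L * Δ * Real.log (K / β)) / √K
    + σw ^ 2 * d * L * Δ * Real.log (K / β) / (lam ^ 2 * K)

/-- The samples `ξ^k ∼ D` and the noise vectors `ω_k ∼ N(0, σw² I)` are all jointly independent. -/
structure FreshSamples {d : ℕ} {Ξ Ω : Type*} [MeasurableSpace Ξ] [MeasurableSpace Ω]
    (P : Measure Ω) (D : Measure Ξ) (σw : ℝ)
    (ξ : ℕ → Ω → Ξ) (w : ℕ → Ω → EuclideanSpace ℝ (Fin d)) : Prop where
  measurable_sample : ∀ k, Measurable (ξ k)
  measurable_noise : ∀ k, Measurable (w k)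
  law_sample : ∀ k, P.map (ξ k) = D
  law_noise : ∀ k, P.map (w k) = multivariateGaussian 0 (σw ^ 2 • (1 : Matrix (Fin d) (Fin d) ℝ))
  indep_steps : iIndepFun (fun k ω => (ξ k ω, w k ω)) P
  indep_sample_noise : ∀ k, IndepFun (ξ k) (w k) P

end DPClippedSGD

end

/-!
By the descent lemma, `f (x^{k+1}) ≤ f (x^k) - γ / 2 * ‖∇ f (x^k)‖ ^ 2` up to an error depending on
the clipped sample and the noise vector of the step. As long as the errors accumulate to less than
`Δ`, the iterates stay in the sublevel set `{f ≤ f* + 2 * Δ}`, and the smallest `‖∇ f (x^k)‖ ^ 2` is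
at most `4 * Δ / (γ * K)`. Two devices give the accumulated error the exponential moments that the
Markov inequality needs: it is stopped once it reaches `Δ` or the iterate leaves the sublevel set,
so that its increments are controlled unconditionally, and a step whose noise is too large for the
descent lemma is recorded as an error of at least `2 * Δ`. With `A = log (K / β)`, the expectation
of `exp (2 * A / Δ * error)` grows by a factor at most `exp (A / K)` per step, so the error reaches
`Δ` with probability at most `exp (-A) = β / K`.

The claim is trivial when `T₁` or `T₃` is at least `L * Δ / 2`, because
`‖∇ f (x⁰)‖ ^ 2 ≤ 2 * L * Δ`. Otherwise `K > 2` and `lam ≥ 3 * √(L * Δ)`, so that gradients of `f`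
are never clipped on the sublevel set, and the term attaining the minimum in the step size dictates
the rate.
-/

namespace DPClippedSGD

theorem isClosed_sublevel_of_continuousAt {X : Type*} [PseudoMetricSpace X] {f : X → ℝ}
    {Q : Set X} {a ρ : ℝ} (hρ : 0 < ρ) (hcont : ∀ x ∈ Q, ContinuousAt f x)
    (hball : ∀ y, f y ≤ a → Metric.closedBall y ρ ⊆ Q) : IsClosed {x | f x ≤ a} := by
  refine isClosed_of_closure_subset fun x hx => ?_
  obtain ⟨y, hy, hxy⟩ := Metric.mem_closure_iff.1 hx ρ hρ
  have := mem_closure_iff_nhdsWithin_neBot.1 hx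
  exact le_of_tendsto (hcont x (hball y hy hxy.le)).continuousWithinAt self_mem_nhdsWithin

theorem segment_sub_smul_subset_of_closedBall_subset {E : Type*} [NormedAddCommGroup E]
    [NormedSpace ℝ E] {f : E → ℝ} {Q : Set E} {a ρ : ℝ} {x v : E} {s t δ : ℝ}
    (hball : ∀ y, f y ≤ a → Metric.closedBall y ρ ⊆ Q) (hs : 0 ≤ s)
    (hpath : ∀ u ∈ Set.Icc 0 s, f (x - u • v) ≤ a) (hδ : 0 ≤ δ) (hδρ : δ * ‖v‖ ≤ ρ)
    (ht : t ∈ Set.Icc 0 (s + δ)) : segment ℝ x (x - t • v) ⊆ Q := by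
  rw [segment_eq_image']
  rintro _ ⟨θ, hθ, rfl⟩
  have hθt : 0 ≤ θ * t := mul_nonneg hθ.1 ht.1
  have hθt_le : θ * t ≤ s + δ := (mul_le_of_le_one_left ht.1 hθ.2).trans ht.2
  have hgap : |θ * t - min (θ * t) s| ≤ δ := by grind
  refine hball _ (hpath _ ⟨le_min hθt hs, min_le_right _ _⟩) ?_
  rw [Metric.mem_closedBall, dist_eq_norm, show x + θ • (x - t • v - x)
    - (x - min (θ * t) s • v) = -((θ * t - min (θ * t) s) • v) by module, norm_neg, norm_smul,
    Real.norm_eq_abs]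
  exact le_trans (by gcongr) hδρ

section SmoothFunction

variable {E : Type*} [NormedAddCommGroup E] [InnerProductSpace ℝ E] [CompleteSpace E]
  {f : E → ℝ} {L : ℝ}

theorem le_add_inner_add_sq_of_lipschitz_gradient {x y : E}
    (hd : ∀ z ∈ segment ℝ x y, DifferentiableAt ℝ f z)
    (hLip : ∀ z ∈ segment ℝ x y, ‖∇ f z - ∇ f x‖ ≤ L * ‖z - x‖) :
    f y ≤ f x + inner ℝ (∇ f x) (y - x) + L / 2 * ‖y - x‖ ^ 2 := by
  set v := y - x
  let φ : ℝ → ℝ := fun t => f (x + t • v) - t * inner ℝ (∇ f x) v - L / 2 * t ^ 2 * ‖v‖ ^ 2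
  have hseg : ∀ t ∈ Set.Icc (0 : ℝ) 1, x + t • v ∈ segment ℝ x y := fun t ht => by
    rw [segment_eq_image']
    exact ⟨t, ht, rfl⟩
  have hφ : ∀ t ∈ Set.Icc (0 : ℝ) 1, HasDerivAt φ
      (inner ℝ (∇ f (x + t • v)) v - inner ℝ (∇ f x) v - L * t * ‖v‖ ^ 2) t := by
    intro t ht
    have hline : HasDerivAt (fun t : ℝ => x + t • v) v t := by
      simpa using ((hasDerivAt_id t).smul_const v).const_add x
    have hf : HasDerivAt (fun t : ℝ => f (x + t • v)) (inner ℝ (∇ f (x + t • v)) v) t := by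
      have := (hd _ (hseg t ht)).hasGradientAt.hasFDerivAt.comp_hasDerivAt t hline
      rwa [InnerProductSpace.toDual_apply_apply] at this
    have hlinear := (hasDerivAt_id t).mul_const (inner ℝ (∇ f x) v)
    have hquadratic := ((hasDerivAt_pow 2 t).const_mul (L / 2)).mul_const (‖v‖ ^ 2)
    exact ((hf.sub hlinear).sub hquadratic).congr_deriv (by push_cast; ring)
  have hanti : AntitoneOn φ (Set.Icc 0 1) := by
    refine antitoneOn_of_deriv_nonpos (convex_Icc 0 1)
      (fun t ht => (hφ t ht).continuousAt.continuousWithinAt)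
      (fun t ht => (hφ t (interior_subset ht)).differentiableAt.differentiableWithinAt)
      fun t ht => ?_
    have ht' := interior_subset ht
    have hcs := (real_inner_le_norm (∇ f (x + t • v) - ∇ f x) v).trans
      (mul_le_mul_of_nonneg_right (hLip _ (hseg t ht')) (norm_nonneg v))
    rw [add_sub_cancel_left, norm_smul, Real.norm_of_nonneg ht'.1] at hcs
    rw [(hφ t ht').deriv, ← inner_sub_left]
    linarith
  have hends := hanti (Set.left_mem_Icc.2 zero_le_one) (Set.right_mem_Icc.2 zero_le_one) zero_le_one
  simp only [φ, v, one_smul, zero_smul, add_zero, one_mul, zero_mul, sub_zero, one_pow, mul_one,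
    zero_pow two_ne_zero, mul_zero, add_sub_cancel] at hends
  linarith

variable {Q : Set E} {a ρ : ℝ} {x : E}

theorem apply_sub_smul_gradient_le (hL : 0 < L) (hd : ∀ x ∈ Q, DifferentiableAt ℝ f x)
    (hLip : ∀ x ∈ Q, ∀ y ∈ Q, ‖∇ f x - ∇ f y‖ ≤ L * ‖x - y‖) {t : ℝ}
    (hseg : segment ℝ x (x - (t / L) • ∇ f x) ⊆ Q) :
    f (x - (t / L) • ∇ f x) ≤ f x - t / L * (1 - t / 2) * ‖∇ f x‖ ^ 2 := by
  have hdescent := le_add_inner_add_sq_of_lipschitz_gradient (fun z hz => hd z (hseg hz))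
    fun z hz => hLip z (hseg hz) x (hseg (left_mem_segment ℝ _ _))
  refine hdescent.trans_eq ?_
  rw [sub_sub_cancel_left, inner_neg_right, inner_smul_right, real_inner_self_eq_norm_sq, norm_neg,
    norm_smul, mul_pow, Real.norm_eq_abs, sq_abs]
  field_simp
  ring

/- The path descends as long as it stays in `Q`, and it stays in `Q` for a little longer than it
stays in the sublevel set. -/
theorem apply_sub_smul_gradient_le_of_closedBall_subset (hL : 0 < L) (hρ : 0 < ρ)
    (hd : ∀ x ∈ Q, DifferentiableAt ℝ f x)
    (hLip : ∀ x ∈ Q, ∀ y ∈ Q, ‖∇ f x - ∇ f y‖ ≤ L * ‖x - y‖)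
    (hball : ∀ y, f y ≤ a → Metric.closedBall y ρ ⊆ Q) (hx : f x ≤ a) {t : ℝ}
    (ht : t ∈ Set.Icc (0 : ℝ) 1) : f (x - (t / L) • ∇ f x) ≤ a := by
  set v := L⁻¹ • ∇ f x
  have hv : ∀ t : ℝ, (t / L) • ∇ f x = t • v := fun t => by rw [smul_smul, div_eq_mul_inv]
  rw [hv]
  obtain ⟨δ, hδ, hδρ⟩ := exists_pos_mul_lt hρ ‖v‖
  suffices hstep : ∀ n : ℕ, ∀ t ∈ Set.Icc 0 (min 1 (n * δ)), f (x - t • v) ≤ a by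
    obtain ⟨n, hn⟩ := exists_nat_ge (t / δ)
    exact hstep n t ⟨ht.1, le_min ht.2 ((div_le_iff₀ hδ).1 hn)⟩
  intro n
  induction n with
  | zero =>
    intro t ht
    obtain rfl : t = 0 := le_antisymm (by simpa using ht.2.trans (min_le_right _ _)) ht.1
    simpa using hx
  | succ n ih =>
    intro t ht
    have ht_one : t ≤ 1 := ht.2.trans (min_le_left _ _)
    have ht_le : t ≤ min 1 (n * δ) + δ := by
      have := ht.2.trans (min_le_right _ _)
      push_cast at this
      rw [← min_add_add_right]
      exact le_min (by linarith) (by linarith)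
    have hseg : segment ℝ x (x - t • v) ⊆ Q := segment_sub_smul_subset_of_closedBall_subset hball
      (by positivity) ih hδ.le (by rw [mul_comm]; exact hδρ.le) ⟨ht.1, ht_le⟩
    have hdecrease : 0 ≤ t / L * (1 - t / 2) * ‖∇ f x‖ ^ 2 :=
      mul_nonneg (mul_nonneg (div_nonneg ht.1 hL.le) (by linarith)) (sq_nonneg _)
    rw [← hv] at hseg ⊢
    exact (apply_sub_smul_gradient_le hL hd hLip hseg).trans (by linarith)

theorem norm_gradient_sq_le (hL : 0 < L) (hρ : 0 < ρ)
    (hd : ∀ x ∈ Q, DifferentiableAt ℝ f x)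
    (hLip : ∀ x ∈ Q, ∀ y ∈ Q, ‖∇ f x - ∇ f y‖ ≤ L * ‖x - y‖)
    (hball : ∀ y, f y ≤ a → Metric.closedBall y ρ ⊆ Q) {m : ℝ} (hm : ∀ x ∈ Q, m ≤ f x)
    (hx : f x ≤ a) : ‖∇ f x‖ ^ 2 ≤ 2 * L * (f x - m) := by
  have hpath : ∀ t ∈ Set.Icc (0 : ℝ) 1, x - (t / L) • ∇ f x ∈ Q := fun t ht =>
    hball _ (apply_sub_smul_gradient_le_of_closedBall_subset hL hρ hd hLip hball hx ht)
      (Metric.mem_closedBall_self hρ.le)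
  have hseg : segment ℝ x (x - ((1 : ℝ) / L) • ∇ f x) ⊆ Q := by
    rw [segment_eq_image']
    rintro _ ⟨θ, hθ, rfl⟩
    convert hpath θ hθ using 1
    module
  have hlower := (hm _ (hpath 1 (by simp))).trans (apply_sub_smul_gradient_le hL hd hLip hseg)
  field_simp at hlower
  linarith

theorem measurable_gradient [MeasurableSpace E] [BorelSpace E] (f : E → ℝ) : Measurable (∇ f) :=
  (InnerProductSpace.toDual ℝ E).symm.continuous.measurable.comp (measurable_fderiv ℝ f)

end SmoothFunction

section Clipping

variable {d : ℕ} {lam α : ℝ} {v G : EuclideanSpace ℝ (Fin d)}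

theorem clip_of_norm_le (hv : ‖v‖ ≤ lam) : clip lam v = v := by
  rcases eq_or_ne v 0 with rfl | hv0
  · simp [clip]
  · rw [clip, min_eq_left ((one_le_div (norm_pos_iff.2 hv0)).2 hv), one_smul]

theorem norm_clip_sub_self (hlam : 0 < lam) (hv : lam ≤ ‖v‖) :
    ‖clip lam v - v‖ = ‖v‖ - lam := by
  have hv0 : 0 < ‖v‖ := hlam.trans_le hv
  have hratio : lam / ‖v‖ ≤ 1 := (div_le_one hv0).2 hv
  have hclip : clip lam v - v = -((1 - lam / ‖v‖) • v) := by
    rw [clip, min_eq_right hratio]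
    module
  rw [hclip, norm_neg, norm_smul, Real.norm_of_nonneg (by linarith)]
  field_simp

theorem norm_clip_le (hlam : 0 < lam) (v : EuclideanSpace ℝ (Fin d)) : ‖clip lam v‖ ≤ lam := by
  rcases le_total ‖v‖ lam with hv | hv
  · rwa [clip_of_norm_le hv]
  · have hv0 : 0 < ‖v‖ := hlam.trans_le hv
    rw [clip, min_eq_right ((div_le_one hv0).2 hv), norm_smul, Real.norm_of_nonneg (by positivity)]
    exact (div_mul_cancel₀ _ hv0.ne').le

theorem norm_clip_sub_le (hlam : 0 < lam) (hG : ‖G‖ ≤ lam) : ‖clip lam v - G‖ ≤ 2 * lam :=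
  (norm_sub_le _ _).trans (by linarith [norm_clip_le hlam v])

theorem norm_clip_sub_self_le (hlam : 0 < lam) (hG : ‖G‖ ≤ lam) :
    ‖clip lam v - v‖ ≤ ‖v - G‖ := by
  rcases le_total ‖v‖ lam with hv | hv
  · simp [clip_of_norm_le hv]
  · rw [norm_clip_sub_self hlam hv]
    linarith [norm_sub_norm_le v G]

theorem norm_clip_sub_self_le_rpow (hlam : 0 < lam) (hα : 1 ≤ α) (hα2 : α ≤ 2)
    (hG : ‖G‖ ≤ 2 * lam / 3) :
    ‖clip lam v - v‖ ≤ 3 * lam ^ (1 - α) * ‖v - G‖ ^ α := by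
  rcases le_total ‖v‖ lam with hv | hv
  · rw [clip_of_norm_le hv, sub_self, norm_zero]
    positivity
  have hfar : lam ≤ 3 * ‖v - G‖ := by linarith [norm_sub_norm_le v G]
  have hpos : 0 < ‖v - G‖ := by linarith
  calc ‖clip lam v - v‖ ≤ ‖v - G‖ := norm_clip_sub_self_le hlam (by linarith)
    _ ≤ ‖v - G‖ * (3 * ‖v - G‖ / lam) ^ (α - 1) :=
      le_mul_of_one_le_right hpos.le (Real.one_le_rpow ((one_le_div hlam).2 hfar) (by linarith))
    _ = 3 ^ (α - 1) * (lam ^ (1 - α) * ‖v - G‖ ^ α) := by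
      rw [Real.div_rpow (by positivity) hlam.le, Real.mul_rpow (by norm_num) hpos.le,
        Real.rpow_sub_one hpos.ne', ← neg_sub α 1, Real.rpow_neg hlam.le]
      field_simp
    _ ≤ 3 ^ (1 : ℝ) * (lam ^ (1 - α) * ‖v - G‖ ^ α) := by
      gcongr
      · norm_num
      · linarith
    _ = 3 * lam ^ (1 - α) * ‖v - G‖ ^ α := by rw [Real.rpow_one, mul_assoc]

theorem norm_clip_sub_sq_le (hlam : 0 < lam) (hα : 0 ≤ α) (hα2 : α ≤ 2) (hG : ‖G‖ ≤ lam) :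
    ‖clip lam v - G‖ ^ 2 ≤ 4 * lam ^ (2 - α) * ‖v - G‖ ^ α := by
  have hle : ‖clip lam v - G‖ ≤ 2 * ‖v - G‖ := by
    have htri := norm_add_le (clip lam v - v) (v - G)
    rw [sub_add_sub_cancel] at htri
    linarith [norm_clip_sub_self_le (v := v) hlam hG]
  rcases (norm_nonneg (clip lam v - G)).eq_or_lt with h0 | hpos
  · rw [← h0, zero_pow two_ne_zero]
    positivity
  calc ‖clip lam v - G‖ ^ 2 = ‖clip lam v - G‖ ^ (2 - α) * ‖clip lam v - G‖ ^ α := by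
        rw [← Real.rpow_add hpos, sub_add_cancel, Real.rpow_two]
    _ ≤ (2 * lam) ^ (2 - α) * (2 * ‖v - G‖) ^ α := by
        gcongr
        exact norm_clip_sub_le hlam hG
    _ = 2 ^ (2 - α) * 2 ^ α * (lam ^ (2 - α) * ‖v - G‖ ^ α) := by
        rw [Real.mul_rpow two_pos.le hlam.le, Real.mul_rpow two_pos.le (norm_nonneg _)]
        ring
    _ = 4 * lam ^ (2 - α) * ‖v - G‖ ^ α := by
        rw [← Real.rpow_add two_pos, sub_add_cancel, Real.rpow_two]
        ring

@[fun_prop]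
theorem measurable_clip (lam : ℝ) : Measurable (clip lam : EuclideanSpace ℝ (Fin d) → _) := by
  unfold clip
  fun_prop

variable {Ξ : Type*} [MeasurableSpace Ξ] {D : Measure Ξ} [IsFiniteMeasure D]
  {g : Ξ → EuclideanSpace ℝ (Fin d)}

theorem integrable_clip (hg : AEMeasurable g D) (hlam : 0 < lam) :
    Integrable (fun i => clip lam (g i)) D :=
  .of_bound ((measurable_clip lam).comp_aemeasurable hg).aestronglyMeasurable lam
    (.of_forall fun _ => norm_clip_le hlam _)

theorem integrable_norm_clip_sub_sq (hg : AEMeasurable g D) (hlam : 0 < lam) (hG : ‖G‖ ≤ lam) :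
    Integrable (fun i => ‖clip lam (g i) - G‖ ^ 2) D := by
  refine .of_bound (C := (2 * lam) ^ 2) ?_ (.of_forall fun i => ?_)
  · exact (((integrable_clip hg hlam).sub (integrable_const G)).aestronglyMeasurable.norm).pow 2
  · rw [norm_pow, norm_norm]
    gcongr
    exact norm_clip_sub_le hlam hG

theorem integral_norm_clip_sub_sq_le (hg : AEMeasurable g D)
    (hmoment : Integrable (fun i => ‖g i - G‖ ^ α) D) (hlam : 0 < lam) (hα : 0 ≤ α)
    (hα2 : α ≤ 2) (hG : ‖G‖ ≤ lam) :
    ∫ i, ‖clip lam (g i) - G‖ ^ 2 ∂D ≤ 4 * lam ^ (2 - α) * ∫ i, ‖g i - G‖ ^ α ∂D := by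
  rw [← integral_const_mul]
  exact integral_mono (integrable_norm_clip_sub_sq hg hlam hG) (hmoment.const_mul _)
    fun i => norm_clip_sub_sq_le hlam hα hα2 hG

theorem norm_integral_clip_sub_integral_le (hg : Integrable g D)
    (hmoment : Integrable (fun i => ‖g i - G‖ ^ α) D) (hlam : 0 < lam) (hα : 1 ≤ α)
    (hα2 : α ≤ 2) (hG : ‖G‖ ≤ 2 * lam / 3) :
    ‖∫ i, clip lam (g i) ∂D - ∫ i, g i ∂D‖
      ≤ 3 * lam ^ (1 - α) * ∫ i, ‖g i - G‖ ^ α ∂D := by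
  rw [← integral_sub (integrable_clip hg.aemeasurable hlam) hg, ← integral_const_mul]
  exact norm_integral_le_of_norm_le (hmoment.const_mul _)
    (.of_forall fun i => norm_clip_sub_self_le_rpow hlam hα hα2 hG)

end Clipping

section ExponentialMoments

theorem lintegral_exp_le_of_abs_le_one {Ω : Type*} [MeasurableSpace Ω] {P : Measure Ω}
    [IsProbabilityMeasure P] {Z : Ω → ℝ} (hZ : AEMeasurable Z P) (hZ1 : ∀ᵐ ω ∂P, |Z ω| ≤ 1) :
    ∫⁻ ω, ENNReal.ofReal (Real.exp (Z ω)) ∂P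
      ≤ ENNReal.ofReal (Real.exp (∫ ω, Z ω ∂P + ∫ ω, Z ω ^ 2 ∂P)) := by
  have hint : Integrable Z P := .of_bound hZ.aestronglyMeasurable 1 hZ1
  have hint_sq : Integrable (fun ω => Z ω ^ 2) P := by
    refine .of_bound (hZ.pow_const 2).aestronglyMeasurable 1 (hZ1.mono fun ω hω => ?_)
    rw [Real.norm_eq_abs, abs_pow]
    exact pow_le_one₀ (abs_nonneg _) hω
  have hexp : ∀ᵐ ω ∂P, Real.exp (Z ω) ≤ 1 + Z ω + Z ω ^ 2 := hZ1.mono fun ω hω => by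
    linarith [(abs_le.1 (Real.abs_exp_sub_one_sub_id_le hω)).2]
  have hone : Integrable (fun ω => 1 + Z ω) P := (integrable_const 1).add hint
  calc ∫⁻ ω, ENNReal.ofReal (Real.exp (Z ω)) ∂P
      ≤ ∫⁻ ω, ENNReal.ofReal (1 + Z ω + Z ω ^ 2) ∂P :=
        lintegral_mono_ae (hexp.mono fun ω hω => ENNReal.ofReal_le_ofReal hω)
    _ = ENNReal.ofReal (∫ ω, (1 + Z ω + Z ω ^ 2) ∂P) :=
        (ofReal_integral_eq_lintegral_ofReal (hone.add hint_sq)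
          (hexp.mono fun ω hω => (Real.exp_pos _).le.trans hω)).symm
    _ = ENNReal.ofReal (∫ ω, Z ω ∂P + ∫ ω, Z ω ^ 2 ∂P + 1) := by
        rw [integral_add hone hint_sq, integral_add (integrable_const 1) hint, integral_const,
          probReal_univ, one_smul]
        congr 1
        ring
    _ ≤ ENNReal.ofReal (Real.exp (∫ ω, Z ω ∂P + ∫ ω, Z ω ^ 2 ∂P)) :=
        ENNReal.ofReal_le_ofReal (Real.add_one_le_exp _)

theorem lintegral_exp_add_le {Ω : Type*} [MeasurableSpace Ω] {P : Measure Ω} {U V : Ω → ℝ}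
    (hU : AEMeasurable U P) {q : ℝ≥0∞}
    (hUq : ∫⁻ ω, ENNReal.ofReal (Real.exp (2 * U ω)) ∂P ≤ q)
    (hVq : ∫⁻ ω, ENNReal.ofReal (Real.exp (2 * V ω)) ∂P ≤ q) :
    ∫⁻ ω, ENNReal.ofReal (Real.exp (U ω + V ω)) ∂P ≤ q := by
  have hle : ∀ ω, 2 * ENNReal.ofReal (Real.exp (U ω + V ω)) ≤
      ENNReal.ofReal (Real.exp (2 * U ω)) + ENNReal.ofReal (Real.exp (2 * V ω)) := fun ω => by
    rw [← ENNReal.ofReal_add (Real.exp_pos _).le (Real.exp_pos _).le, ← ENNReal.ofReal_ofNat 2,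
      ← ENNReal.ofReal_mul two_pos.le, two_mul (U ω), two_mul (V ω), Real.exp_add, Real.exp_add,
      Real.exp_add]
    exact ENNReal.ofReal_le_ofReal (by nlinarith [sq_nonneg (Real.exp (U ω) - Real.exp (V ω))])
  rw [← ENNReal.mul_le_mul_iff_right two_ne_zero ENNReal.ofNat_ne_top]
  calc 2 * ∫⁻ ω, ENNReal.ofReal (Real.exp (U ω + V ω)) ∂P
      ≤ ∫⁻ ω, (ENNReal.ofReal (Real.exp (2 * U ω)) + ENNReal.ofReal (Real.exp (2 * V ω))) ∂P := by
        rw [← lintegral_const_mul' _ _ ENNReal.ofNat_ne_top]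
        exact lintegral_mono hle
    _ ≤ 2 * q := by
        rw [lintegral_add_left' (hU.const_mul 2).exp.ennreal_ofReal, two_mul]
        gcongr

theorem lintegral_exp_mul_sq_gaussianReal (v : NNReal) {b : ℝ} (hbv : 2 * b * v < 1) :
    ∫⁻ z, ENNReal.ofReal (Real.exp (b * z ^ 2)) ∂(gaussianReal 0 v)
      = ENNReal.ofReal (√(1 - 2 * b * v))⁻¹ := by
  rcases eq_or_ne v 0 with rfl | hv
  · simp
  have hrate : 0 < (1 - 2 * b * v) / (2 * v) := div_pos (by linarith) (by positivity)
  rw [gaussianReal_of_var_ne_zero _ hv, lintegral_withDensity_eq_lintegral_mul _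
    (measurable_gaussianPDF 0 v) (by fun_prop)]
  have hdensity : ∀ z : ℝ, (gaussianPDF 0 v * fun z => ENNReal.ofReal (Real.exp (b * z ^ 2))) z
      = ENNReal.ofReal
        ((√(2 * Real.pi * v))⁻¹ * Real.exp (-((1 - 2 * b * v) / (2 * v)) * z ^ 2)) := by
    intro z
    rw [Pi.mul_apply, gaussianPDF, ← ENNReal.ofReal_mul (gaussianPDFReal_nonneg _ _ _),
      gaussianPDFReal, mul_assoc, ← Real.exp_add]
    congr 3
    field_simp
    ring
  simp_rw [hdensity]
  rw [← ofReal_integral_eq_lintegral_ofReal ((integrable_exp_neg_mul_sq hrate).const_mul _)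
    (.of_forall fun z => by positivity), integral_const_mul, integral_gaussian,
    ← Real.sqrt_inv, ← Real.sqrt_inv, ← Real.sqrt_mul (by positivity)]
  congr 2
  field_simp

theorem lintegral_exp_mul_sq_gaussianReal_le (v : NNReal) {b : ℝ} (hb : 0 ≤ b)
    (hbv : b * v ≤ 1 / 4) :
    ∫⁻ z, ENNReal.ofReal (Real.exp (b * z ^ 2)) ∂(gaussianReal 0 v)
      ≤ ENNReal.ofReal (Real.exp (2 * (b * v))) := by
  have hpos : 0 < 1 - 2 * b * v := by linarith
  have hbv0 : 0 ≤ b * v := by positivity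
  have hexp := Real.add_one_le_exp (4 * (b * v))
  rw [lintegral_exp_mul_sq_gaussianReal v (by linarith)]
  refine ENNReal.ofReal_le_ofReal ?_
  rw [← Real.sqrt_inv, Real.sqrt_le_left (Real.exp_pos _).le, ← Real.exp_nat_mul,
    inv_le_iff_one_le_mul₀ hpos, show (2 : ℕ) * (2 * (b * v)) = 4 * (b * v) by push_cast; ring]
  calc (1 : ℝ) ≤ (4 * (b * v) + 1) * (1 - 2 * b * v) := by nlinarith
    _ ≤ Real.exp (4 * (b * v)) * (1 - 2 * b * v) := by gcongr

theorem lintegral_exp_dual_of_isGaussian {E : Type*} [NormedAddCommGroup E] [NormedSpace ℝ E]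
    [MeasurableSpace E] [BorelSpace E] (μ : Measure E) [IsGaussian μ] (φ : StrongDual ℝ E) :
    ∫⁻ x, ENNReal.ofReal (Real.exp (φ x)) ∂μ
      = ENNReal.ofReal (Real.exp (μ[φ] + Var[φ; μ] / 2)) := by
  have hmgf := congrFun (mgf_fun_id_gaussianReal (μ := μ[φ]) (v := Var[φ; μ].toNNReal)) 1
  have hint := integrable_exp_mul_gaussianReal (μ := μ[φ]) (v := Var[φ; μ].toNNReal) 1
  simp only [mgf, one_mul, one_pow, mul_one] at hmgf hint
  rw [Real.coe_toNNReal _ (variance_nonneg _ _)] at hmgf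
  rw [← hmgf, ofReal_integral_eq_lintegral_ofReal hint (.of_forall fun z => (Real.exp_pos z).le),
    ← IsGaussian.map_eq_gaussianReal, lintegral_map (by fun_prop) (by fun_prop)]

variable {ι : Type*} [Fintype ι]

theorem exp_mul_norm_sq_le_sum [Nonempty ι] (b : ℝ) (w : EuclideanSpace ℝ ι) :
    Real.exp (b * ‖w‖ ^ 2)
      ≤ ∑ i, (Fintype.card ι : ℝ)⁻¹ * Real.exp (b * Fintype.card ι * w i ^ 2) := by
  have hcard : (Fintype.card ι : ℝ) ≠ 0 := Nat.cast_ne_zero.2 Fintype.card_ne_zero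
  have hjensen := convexOn_exp.map_sum_le (t := Finset.univ)
    (w := fun _ : ι => (Fintype.card ι : ℝ)⁻¹) (p := fun i => b * Fintype.card ι * w i ^ 2)
    (fun _ _ => by positivity) (by simp [hcard]) (fun _ _ => Set.mem_univ _)
  simp only [smul_eq_mul] at hjensen
  refine le_of_eq_of_le ?_ hjensen
  rw [EuclideanSpace.norm_sq_eq, Finset.mul_sum]
  congr 1
  refine Finset.sum_congr rfl fun i _ => ?_
  rw [Real.norm_eq_abs, sq_abs]
  field_simp

theorem lintegral_exp_mul_norm_sq_le [Nonempty ι] {μ : Measure (EuclideanSpace ℝ ι)} {b : ℝ}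
    {q : ℝ≥0∞}
    (hq : ∀ i, ∫⁻ w, ENNReal.ofReal (Real.exp (b * Fintype.card ι * w i ^ 2)) ∂μ ≤ q) :
    ∫⁻ w, ENNReal.ofReal (Real.exp (b * ‖w‖ ^ 2)) ∂μ ≤ q := by
  have hcard : (Fintype.card ι : ℝ) ≠ 0 := Nat.cast_ne_zero.2 Fintype.card_ne_zero
  calc ∫⁻ w, ENNReal.ofReal (Real.exp (b * ‖w‖ ^ 2)) ∂μ
      ≤ ∫⁻ w : EuclideanSpace ℝ ι, ∑ i, ENNReal.ofReal (Fintype.card ι : ℝ)⁻¹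
          * ENNReal.ofReal (Real.exp (b * Fintype.card ι * w i ^ 2)) ∂μ := by
        refine lintegral_mono fun w => ?_
        simp only [← ENNReal.ofReal_mul (inv_nonneg.2 (Nat.cast_nonneg (Fintype.card ι)))]
        rw [← ENNReal.ofReal_sum_of_nonneg fun _ _ => by positivity]
        exact ENNReal.ofReal_le_ofReal (exp_mul_norm_sq_le_sum b w)
    _ = ∑ i, ENNReal.ofReal (Fintype.card ι : ℝ)⁻¹
          * ∫⁻ w, ENNReal.ofReal (Real.exp (b * Fintype.card ι * w i ^ 2)) ∂μ := by
        rw [lintegral_finsetSum _ fun i _ => by fun_prop]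
        exact Finset.sum_congr rfl fun i _ => lintegral_const_mul _ (by fun_prop)
    _ ≤ ∑ _i : ι, ENNReal.ofReal (Fintype.card ι : ℝ)⁻¹ * q := by
        gcongr with i
        exact hq i
    _ = q := by
        rw [Finset.sum_const, Finset.card_univ, nsmul_eq_mul, ← mul_assoc,
          ← ENNReal.ofReal_natCast, ← ENNReal.ofReal_mul (Nat.cast_nonneg _),
          mul_inv_cancel₀ hcard, ENNReal.ofReal_one, one_mul]

end ExponentialMoments

section NoiseLaw

theorem posSemidef_sq_smul_one {ι : Type*} [DecidableEq ι] (σw : ℝ) :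
    (σw ^ 2 • (1 : Matrix ι ι ℝ)).PosSemidef :=
  Matrix.PosSemidef.one.smul (sq_nonneg σw)

/-- The law `N(0, σw² I)` of the noise vectors. -/
noncomputable abbrev noiseLaw (ι : Type*) [Fintype ι] [DecidableEq ι] (σw : ℝ) :
    Measure (EuclideanSpace ℝ ι) :=
  multivariateGaussian 0 (σw ^ 2 • (1 : Matrix ι ι ℝ))

variable {ι : Type*} [Fintype ι] [DecidableEq ι] {σw : ℝ}

theorem variance_inner_noiseLaw (u : EuclideanSpace ℝ ι) :
    Var[fun w => inner ℝ u w; noiseLaw ι σw] = σw ^ 2 * ‖u‖ ^ 2 := by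
  rw [← covarianceBilin_self IsGaussian.memLp_two_id,
    covarianceBilin_multivariateGaussian (posSemidef_sq_smul_one σw), Matrix.smul_mulVec,
    Matrix.one_mulVec, dotProduct_smul, smul_eq_mul, EuclideanSpace.norm_sq_eq]
  simp [dotProduct, sq]

theorem lintegral_exp_inner_noiseLaw (u : EuclideanSpace ℝ ι) :
    ∫⁻ w, ENNReal.ofReal (Real.exp (inner ℝ u w)) ∂(noiseLaw ι σw)
      = ENNReal.ofReal (Real.exp (σw ^ 2 * ‖u‖ ^ 2 / 2)) := by
  have hmean : ∫ w, inner ℝ u w ∂(noiseLaw ι σw) = 0 := by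
    rw [integral_inner (𝕜 := ℝ) (f := fun w => w) IsGaussian.integrable_fun_id u,
      integral_id_multivariateGaussian, inner_zero_right]
  have hexp := lintegral_exp_dual_of_isGaussian (noiseLaw ι σw) (innerSL ℝ u)
  simp only [coe_innerSL_apply] at hexp
  rw [hexp, hmean, variance_inner_noiseLaw, zero_add]

theorem lintegral_exp_mul_norm_sq_noiseLaw_le {b : ℝ} (hb : 0 ≤ b)
    (hbσ : b * Fintype.card ι * σw ^ 2 ≤ 1 / 4) :
    ∫⁻ w, ENNReal.ofReal (Real.exp (b * ‖w‖ ^ 2)) ∂(noiseLaw ι σw)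
      ≤ ENNReal.ofReal (Real.exp (2 * (b * Fintype.card ι * σw ^ 2))) := by
  rcases isEmpty_or_nonempty ι with hι | hι
  · simp [Subsingleton.elim (α := EuclideanSpace ℝ ι) _ 0]
  refine lintegral_exp_mul_norm_sq_le fun i => ?_
  have hvar : (((σw ^ 2 • (1 : Matrix ι ι ℝ)) i i).toNNReal : ℝ) = σw ^ 2 := by
    rw [Matrix.smul_apply, Matrix.one_apply_eq, smul_eq_mul, mul_one,
      Real.coe_toNNReal _ (sq_nonneg _)]
  have hcoord := measurePreserving_eval_multivariateGaussian (μ := 0)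
    (posSemidef_sq_smul_one (ι := ι) σw) (i := i)
  rw [hcoord.lintegral_comp (f := fun z => ENNReal.ofReal (Real.exp (b * Fintype.card ι * z ^ 2)))
    (by fun_prop)]
  refine (lintegral_exp_mul_sq_gaussianReal_le _ (by positivity) (by rwa [hvar])).trans_eq ?_
  rw [hvar]

end NoiseLaw

section StepErrors

variable {d : ℕ}

/-- The contribution of the clipped gradient sample `g` to the error of one step, relative to the
noiseless descent inequality at a point with gradient `G`. -/
noncomputable def sampleError (L γ lam : ℝ) (G g : EuclideanSpace ℝ (Fin d)) : ℝ :=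
  -γ * inner ℝ G (clip lam g - G) + 2 * L * γ ^ 2 * ‖clip lam g - G‖ ^ 2

/-- The contribution of the noise vector `w` to the error of one step from a point with gradient
`G`. The factor `10000` overestimates the second-order effect of the noise, so that a step with
large noise is recorded as a large error. -/
noncomputable def noiseError (L γ : ℝ) (G w : EuclideanSpace ℝ (Fin d)) : ℝ :=
  -γ * inner ℝ G w + 10000 * L * γ ^ 2 * ‖w‖ ^ 2

/-- The total error of one step along the gradient sample `g` and the noise vector `w`. -/
noncomputable def stepError (L γ lam : ℝ) (G g w : EuclideanSpace ℝ (Fin d)) : ℝ :=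
  sampleError L γ lam G g + noiseError L γ G w

/-- The restrictions on the step size `γ` under which the errors of `K` steps accumulate to less
than `L * r ^ 2` with probability at least `1 - exp (-A)`. In the theorem `A = log (K / β)`,
`r = √(Δ / L)`, and `s` is the relative noise level `(σ ^ α + ζ ^ α) / lam ^ α`. -/
structure TunedStepsize (d : ℕ) (K A s L r lam σw γ : ℝ) : Prop where
  one_le_K : 1 ≤ K
  half_le_A : 1 / 2 ≤ A
  s_pos : 0 < s
  L_pos : 0 < L
  r_pos : 0 < r
  lam_pos : 0 < lam
  γ_pos : 0 < γ
  smoothness : γ * L ≤ 1 / 600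
  variance : γ ^ 2 * lam ^ 2 * K * A * s ≤ r ^ 2 / 360000
  bias : γ * K * s * lam ≤ r / 150
  range : γ * lam * A ≤ r / 80
  noise : γ ^ 2 * σw ^ 2 * d * K * A ≤ r ^ 2 / 360000

namespace TunedStepsize

variable {K A s L r lam σw γ : ℝ} {v G : EuclideanSpace ℝ (Fin d)}

theorem A_pos (h : TunedStepsize d K A s L r lam σw γ) : 0 < A :=
  one_half_pos.trans_le h.half_le_A

theorem K_pos (h : TunedStepsize d K A s L r lam σw γ) : 0 < K :=
  one_pos.trans_le h.one_le_K

theorem mul_lam_le (h : TunedStepsize d K A s L r lam σw γ) : γ * lam ≤ r / 40 := by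
  nlinarith [h.range, h.half_le_A, mul_pos h.γ_pos h.lam_pos]

theorem mul_norm_clip_sub_le (h : TunedStepsize d K A s L r lam σw γ) (hG : ‖G‖ ≤ lam) :
    γ * ‖clip lam v - G‖ ≤ r / 20 := by
  have := mul_le_mul_of_nonneg_left (norm_clip_sub_le (v := v) h.lam_pos hG) h.γ_pos.le
  linarith [h.mul_lam_le]

theorem abs_sampleError_le (h : TunedStepsize d K A s L r lam σw γ) (hG : ‖G‖ ≤ lam)
    (hGL : ‖G‖ ≤ 2 * (L * r)) :
    |sampleError L γ lam G v| ≤ 4 * γ * L * r * ‖clip lam v - G‖ := by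
  have hγ := h.γ_pos
  have hL := h.L_pos
  have hγX := h.mul_norm_clip_sub_le (v := v) hG
  unfold sampleError
  set X := clip lam v - G
  have hinner : |inner ℝ G X| ≤ 2 * (L * r) * ‖X‖ := (abs_real_inner_le_norm _ _).trans (by gcongr)
  calc |-γ * inner ℝ G X + 2 * L * γ ^ 2 * ‖X‖ ^ 2|
      ≤ |-γ * inner ℝ G X| + |2 * L * γ ^ 2 * ‖X‖ ^ 2| := abs_add_le _ _
    _ = γ * |inner ℝ G X| + 2 * L * γ * ‖X‖ * (γ * ‖X‖) := by
      rw [abs_mul, abs_neg, abs_of_pos hγ, abs_of_nonneg (by positivity : 0 ≤ 2 * L * γ ^ 2 * _)]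
      ring
    _ ≤ γ * (2 * (L * r) * ‖X‖) + 2 * L * γ * ‖X‖ * r := by
      gcongr
      linarith [h.r_pos]
    _ = 4 * γ * L * r * ‖X‖ := by ring

theorem abs_tilt_mul_sampleError_le_one (h : TunedStepsize d K A s L r lam σw γ) (hG : ‖G‖ ≤ lam)
    (hGL : ‖G‖ ≤ 2 * (L * r)) : |4 * A / (L * r ^ 2) * sampleError L γ lam G v| ≤ 1 := by
  have hA := h.A_pos
  have hL := h.L_pos
  have hr := h.r_pos
  have hγ := h.γ_pos
  calc |4 * A / (L * r ^ 2) * sampleError L γ lam G v|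
      = 4 * A / (L * r ^ 2) * |sampleError L γ lam G v| := by
        rw [abs_mul, abs_of_pos (by positivity)]
    _ ≤ 4 * A / (L * r ^ 2) * (4 * γ * L * r * (2 * lam)) := by
      gcongr
      exact (h.abs_sampleError_le hG hGL).trans (by gcongr; exact norm_clip_sub_le h.lam_pos hG)
    _ = 32 / r * (γ * lam * A) := by field_simp; ring
    _ ≤ 32 / r * (r / 80) := by gcongr; exact h.range
    _ ≤ 1 := by field_simp; norm_num

section Oracle

variable {Ξ : Type*} [MeasurableSpace Ξ] {D : Measure Ξ} [IsProbabilityMeasure D]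
  {g : Ξ → EuclideanSpace ℝ (Fin d)} {α : ℝ}

theorem integral_norm_clip_sub_sq_le (h : TunedStepsize d K A s L r lam σw γ)
    (hg : AEMeasurable g D) (hmoment : Integrable (fun i => ‖g i - G‖ ^ α) D)
    (hs : ∫ i, ‖g i - G‖ ^ α ∂D ≤ s * lam ^ α) (hα : 0 ≤ α) (hα2 : α ≤ 2) (hG : ‖G‖ ≤ lam) :
    ∫ i, ‖clip lam (g i) - G‖ ^ 2 ∂D ≤ 4 * lam ^ 2 * s := by
  have hlam := h.lam_pos
  calc ∫ i, ‖clip lam (g i) - G‖ ^ 2 ∂D ≤ 4 * lam ^ (2 - α) * ∫ i, ‖g i - G‖ ^ α ∂D :=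
        DPClippedSGD.integral_norm_clip_sub_sq_le hg hmoment hlam hα hα2 hG
    _ ≤ 4 * lam ^ (2 - α) * (s * lam ^ α) := by gcongr
    _ = 4 * (lam ^ (2 - α) * lam ^ α) * s := by ring
    _ = 4 * lam ^ 2 * s := by rw [← Real.rpow_add hlam, sub_add_cancel, Real.rpow_two]

theorem neg_integral_inner_clip_sub_le (h : TunedStepsize d K A s L r lam σw γ)
    (hg : Integrable g D) (hgG : ∫ i, g i ∂D = G)
    (hmoment : Integrable (fun i => ‖g i - G‖ ^ α) D)
    (hs : ∫ i, ‖g i - G‖ ^ α ∂D ≤ s * lam ^ α) (hα : 1 ≤ α) (hα2 : α ≤ 2)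
    (hG : ‖G‖ ≤ 2 * lam / 3) :
    -∫ i, inner ℝ G (clip lam (g i) - G) ∂D ≤ ‖G‖ * (3 * lam * s) := by
  have hlam := h.lam_pos
  have hclip := integrable_clip hg.aemeasurable hlam
  calc -∫ i, inner ℝ G (clip lam (g i) - G) ∂D
      = -inner ℝ G (∫ i, clip lam (g i) ∂D - ∫ i, g i ∂D) := by
        rw [integral_inner (f := fun i => clip lam (g i) - G) (hclip.sub (integrable_const G)),
          integral_sub hclip (integrable_const G), integral_const, probReal_univ, one_smul, hgG]
    _ ≤ ‖G‖ * ‖∫ i, clip lam (g i) ∂D - ∫ i, g i ∂D‖ :=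
        (neg_le_abs _).trans (abs_real_inner_le_norm _ _)
    _ ≤ ‖G‖ * (3 * lam ^ (1 - α) * (s * lam ^ α)) := by
        gcongr
        refine (norm_integral_clip_sub_integral_le hg hmoment hlam hα hα2 hG).trans ?_
        gcongr
    _ = ‖G‖ * (3 * (lam ^ (1 - α) * lam ^ α) * s) := by ring
    _ = ‖G‖ * (3 * lam * s) := by rw [← Real.rpow_add hlam, sub_add_cancel, Real.rpow_one]

theorem integral_sampleError_le (h : TunedStepsize d K A s L r lam σw γ)
    (hg : Integrable g D) (hgG : ∫ i, g i ∂D = G)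
    (hmoment : Integrable (fun i => ‖g i - G‖ ^ α) D)
    (hs : ∫ i, ‖g i - G‖ ^ α ∂D ≤ s * lam ^ α) (hα : 1 ≤ α) (hα2 : α ≤ 2)
    (hG : ‖G‖ ≤ 2 * lam / 3) (hGL : ‖G‖ ≤ 2 * (L * r)) :
    ∫ i, sampleError L γ lam G (g i) ∂D
      ≤ 6 * L * r * (γ * s * lam) + 8 * L * (γ ^ 2 * lam ^ 2 * s) := by
  have hγ := h.γ_pos
  have hL := h.L_pos
  have hlam := h.lam_pos
  have hs0 := h.s_pos
  have hGlam : ‖G‖ ≤ lam := by linarith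
  have hmean := h.neg_integral_inner_clip_sub_le hg hgG hmoment hs hα hα2 hG
  have hsq := h.integral_norm_clip_sub_sq_le hg.aemeasurable hmoment hs (by linarith) hα2 hGlam
  have hint : Integrable (fun i => clip lam (g i) - G) D :=
    (integrable_clip hg.aemeasurable hlam).sub (integrable_const G)
  have hint_sq := integrable_norm_clip_sub_sq hg.aemeasurable hlam hGlam
  calc ∫ i, sampleError L γ lam G (g i) ∂D
      = γ * -∫ i, inner ℝ G (clip lam (g i) - G) ∂D
          + 2 * L * γ ^ 2 * ∫ i, ‖clip lam (g i) - G‖ ^ 2 ∂D := by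
        unfold sampleError
        rw [integral_add ((hint.const_inner G).const_mul _) (hint_sq.const_mul _),
          integral_const_mul, integral_const_mul, neg_mul, mul_neg]
    _ ≤ γ * (2 * (L * r) * (3 * lam * s)) + 2 * L * γ ^ 2 * (4 * lam ^ 2 * s) := by
        gcongr
        exact hmean.trans (by gcongr)
    _ = 6 * L * r * (γ * s * lam) + 8 * L * (γ ^ 2 * lam ^ 2 * s) := by ring

theorem tilt_mul_integral_sampleError_le (h : TunedStepsize d K A s L r lam σw γ)
    (hg : Integrable g D) (hgG : ∫ i, g i ∂D = G)
    (hmoment : Integrable (fun i => ‖g i - G‖ ^ α) D)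
    (hs : ∫ i, ‖g i - G‖ ^ α ∂D ≤ s * lam ^ α) (hα : 1 ≤ α) (hα2 : α ≤ 2)
    (hG : ‖G‖ ≤ 2 * lam / 3) (hGL : ‖G‖ ≤ 2 * (L * r)) :
    4 * A / (L * r ^ 2) * ∫ i, sampleError L γ lam G (g i) ∂D ≤ A / (2 * K) := by
  have hA := h.A_pos
  have hK := h.K_pos
  have hL := h.L_pos
  have hr := h.r_pos
  have hbias : γ * s * lam ≤ r / 150 / K := by rw [le_div_iff₀ hK]; linarith [h.bias]
  have hvar : γ ^ 2 * lam ^ 2 * s * A ≤ r ^ 2 / 360000 / K := by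
    rw [le_div_iff₀ hK]; linarith [h.variance]
  calc 4 * A / (L * r ^ 2) * ∫ i, sampleError L γ lam G (g i) ∂D
      ≤ 4 * A / (L * r ^ 2) * (6 * L * r * (γ * s * lam) + 8 * L * (γ ^ 2 * lam ^ 2 * s)) := by
        gcongr
        exact h.integral_sampleError_le hg hgG hmoment hs hα hα2 hG hGL
    _ = 24 * A / r * (γ * s * lam) + 32 / r ^ 2 * (γ ^ 2 * lam ^ 2 * s * A) := by
        field_simp; ring
    _ ≤ 24 * A / r * (r / 150 / K) + 32 / r ^ 2 * (r ^ 2 / 360000 / K) := by gcongr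
    _ = (24 * A / 150 + 32 / 360000) / K := by field_simp
    _ ≤ A / 2 / K := by gcongr; linarith [h.half_le_A]
    _ = A / (2 * K) := by rw [div_div]

theorem integral_tilt_mul_sampleError_sq_le (h : TunedStepsize d K A s L r lam σw γ)
    (hg : AEMeasurable g D) (hmoment : Integrable (fun i => ‖g i - G‖ ^ α) D)
    (hs : ∫ i, ‖g i - G‖ ^ α ∂D ≤ s * lam ^ α) (hα : 0 ≤ α) (hα2 : α ≤ 2)
    (hG : ‖G‖ ≤ lam) (hGL : ‖G‖ ≤ 2 * (L * r)) :
    ∫ i, (4 * A / (L * r ^ 2) * sampleError L γ lam G (g i)) ^ 2 ∂D ≤ A / (2 * K) := by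
  have hA := h.A_pos
  have hK := h.K_pos
  have hL := h.L_pos
  have hr := h.r_pos
  have hvar : γ ^ 2 * lam ^ 2 * s * A ≤ r ^ 2 / 360000 / K := by
    rw [le_div_iff₀ hK]; linarith [h.variance]
  calc ∫ i, (4 * A / (L * r ^ 2) * sampleError L γ lam G (g i)) ^ 2 ∂D
      ≤ ∫ i, (4 * A / (L * r ^ 2) * (4 * γ * L * r)) ^ 2 * ‖clip lam (g i) - G‖ ^ 2 ∂D := by
        refine integral_mono_of_nonneg (.of_forall fun i => sq_nonneg _)
          ((integrable_norm_clip_sub_sq hg h.lam_pos hG).const_mul _) (.of_forall fun i => ?_)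
        dsimp only
        rw [mul_pow, mul_pow (4 * A / _), mul_assoc, ← mul_pow _ ‖_‖]
        gcongr ?_ * ?_
        exact sq_le_sq.2 ((h.abs_sampleError_le hG hGL).trans (le_abs_self _))
    _ ≤ (4 * A / (L * r ^ 2) * (4 * γ * L * r)) ^ 2 * (4 * lam ^ 2 * s) := by
        rw [integral_const_mul]
        gcongr
        exact h.integral_norm_clip_sub_sq_le hg hmoment hs hα hα2 hG
    _ = 1024 * A / r ^ 2 * (γ ^ 2 * lam ^ 2 * s * A) := by field_simp; ring
    _ ≤ 1024 * A / r ^ 2 * (r ^ 2 / 360000 / K) := by gcongr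
    _ = 1024 / 360000 * (A / K) := by field_simp
    _ ≤ 1 / 2 * (A / K) := mul_le_mul_of_nonneg_right (by norm_num) (by positivity)
    _ = A / (2 * K) := by ring

theorem lintegral_exp_sampleError_le (h : TunedStepsize d K A s L r lam σw γ)
    (hg : Integrable g D) (hgG : ∫ i, g i ∂D = G)
    (hmoment : Integrable (fun i => ‖g i - G‖ ^ α) D)
    (hs : ∫ i, ‖g i - G‖ ^ α ∂D ≤ s * lam ^ α) (hα : 1 ≤ α) (hα2 : α ≤ 2)
    (hG : ‖G‖ ≤ 2 * lam / 3) (hGL : ‖G‖ ≤ 2 * (L * r)) :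
    ∫⁻ i, ENNReal.ofReal (Real.exp (4 * A / (L * r ^ 2) * sampleError L γ lam G (g i))) ∂D
      ≤ ENNReal.ofReal (Real.exp (A / K)) := by
  have hGlam : ‖G‖ ≤ lam := by linarith [h.lam_pos]
  have hmeas : AEMeasurable (fun i => 4 * A / (L * r ^ 2) * sampleError L γ lam G (g i)) D := by
    have := (measurable_clip (d := d) lam).comp_aemeasurable hg.aemeasurable
    unfold sampleError
    fun_prop
  refine (lintegral_exp_le_of_abs_le_one hmeas
    (.of_forall fun i => h.abs_tilt_mul_sampleError_le_one hGlam hGL)).trans ?_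
  refine ENNReal.ofReal_le_ofReal (Real.exp_le_exp.2 ?_)
  rw [integral_const_mul]
  calc _ ≤ A / (2 * K) + A / (2 * K) := add_le_add
        (h.tilt_mul_integral_sampleError_le hg hgG hmoment hs hα hα2 hG hGL)
        (h.integral_tilt_mul_sampleError_sq_le hg.aemeasurable hmoment hs (by linarith) hα2
          hGlam hGL)
    _ = A / K := by ring

end Oracle

theorem lintegral_exp_inner_noise_le (h : TunedStepsize d K A s L r lam σw γ)
    (hGL : ‖G‖ ≤ 2 * (L * r)) :
    ∫⁻ w, ENNReal.ofReal (Real.exp (2 * (4 * A / (L * r ^ 2) * (-γ * inner ℝ G w))))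
        ∂(noiseLaw (Fin d) σw) ≤ ENNReal.ofReal (Real.exp (A / K)) := by
  have hL := h.L_pos
  have hr := h.r_pos
  have hA := h.A_pos
  have hK := h.K_pos
  have hnoise : γ ^ 2 * σw ^ 2 * d * A ≤ r ^ 2 / 360000 / K := by
    rw [le_div_iff₀ hK]; linarith [h.noise]
  have hG : ‖G‖ ^ 2 ≤ d * (2 * (L * r)) ^ 2 := by
    rcases d.eq_zero_or_pos with rfl | hd
    · simp [Subsingleton.elim G 0]
    · exact (pow_le_pow_left₀ (norm_nonneg G) hGL 2).trans
        (le_mul_of_one_le_left (sq_nonneg _) (by exact_mod_cast hd))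
  have hscale : ∀ w, 2 * (4 * A / (L * r ^ 2) * (-γ * inner ℝ G w))
      = inner ℝ (-(8 * A / (L * r ^ 2) * γ) • G) w := fun w => by
    rw [real_inner_smul_left]; ring
  simp_rw [hscale]
  rw [lintegral_exp_inner_noiseLaw]
  refine ENNReal.ofReal_le_ofReal (Real.exp_le_exp.2 ?_)
  rw [norm_smul, mul_pow, Real.norm_eq_abs, sq_abs, neg_sq]
  calc σw ^ 2 * ((8 * A / (L * r ^ 2) * γ) ^ 2 * ‖G‖ ^ 2) / 2
      ≤ σw ^ 2 * ((8 * A / (L * r ^ 2) * γ) ^ 2 * (d * (2 * (L * r)) ^ 2)) / 2 := by gcongr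
    _ = 128 * A / r ^ 2 * (γ ^ 2 * σw ^ 2 * d * A) := by field_simp; ring
    _ ≤ 128 * A / r ^ 2 * (r ^ 2 / 360000 / K) := by gcongr
    _ = A / K * (128 / 360000) := by field_simp
    _ ≤ A / K := mul_le_of_le_one_right (by positivity) (by norm_num)

theorem lintegral_exp_norm_sq_noise_le (h : TunedStepsize d K A s L r lam σw γ) :
    ∫⁻ w, ENNReal.ofReal (Real.exp
        (2 * (4 * A / (L * r ^ 2) * (10000 * L * γ ^ 2 * ‖w‖ ^ 2)))) ∂(noiseLaw (Fin d) σw)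
      ≤ ENNReal.ofReal (Real.exp (A / K)) := by
  have hL := h.L_pos
  have hr := h.r_pos
  have hA := h.A_pos
  have hK := h.K_pos
  have hnoise : γ ^ 2 * σw ^ 2 * d * A ≤ r ^ 2 / 360000 / K := by
    rw [le_div_iff₀ hK]; linarith [h.noise]
  have hscale : ∀ w : EuclideanSpace ℝ (Fin d),
      2 * (4 * A / (L * r ^ 2) * (10000 * L * γ ^ 2 * ‖w‖ ^ 2))
        = 80000 * A * γ ^ 2 / r ^ 2 * ‖w‖ ^ 2 := fun w => by field_simp; ring
  have hrate : 80000 * A * γ ^ 2 / r ^ 2 * Fintype.card (Fin d) * σw ^ 2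
      ≤ 80000 / 360000 / K := by
    rw [Fintype.card_fin]
    calc _ = 80000 / r ^ 2 * (γ ^ 2 * σw ^ 2 * d * A) := by field_simp
      _ ≤ 80000 / r ^ 2 * (r ^ 2 / 360000 / K) := by gcongr
      _ = 80000 / 360000 / K := by field_simp
  have hquarter : (80000 / 360000 : ℝ) / K ≤ 80000 / 360000 :=
    div_le_self (by norm_num) h.one_le_K
  simp_rw [hscale]
  refine (lintegral_exp_mul_norm_sq_noiseLaw_le (by positivity) (by linarith)).trans ?_
  refine ENNReal.ofReal_le_ofReal (Real.exp_le_exp.2 ?_)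
  calc _ ≤ 2 * (80000 / 360000 / K) := by gcongr
    _ = 2 * (80000 / 360000) / K := by ring
    _ ≤ A / K := by gcongr; linarith [h.half_le_A]

theorem lintegral_exp_noiseError_le (h : TunedStepsize d K A s L r lam σw γ)
    (hGL : ‖G‖ ≤ 2 * (L * r)) :
    ∫⁻ w, ENNReal.ofReal (Real.exp (4 * A / (L * r ^ 2) * noiseError L γ G w))
      ∂(noiseLaw (Fin d) σw) ≤ ENNReal.ofReal (Real.exp (A / K)) := by
  simp_rw [noiseError, mul_add]
  exact lintegral_exp_add_le (by fun_prop) (h.lintegral_exp_inner_noise_le hGL)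
    h.lintegral_exp_norm_sq_noise_le

end TunedStepsize

end StepErrors

section Descent

variable {d : ℕ} {f : EuclideanSpace ℝ (Fin d) → ℝ} {Q : Set (EuclideanSpace ℝ (Fin d))}
  {fstar K A s L r lam σw γ : ℝ} {x G g w : EuclideanSpace ℝ (Fin d)}

/-- `f` is smooth and at least `fstar` on a set `Q` that contains all points within `r / 20` of the
sublevel set `{f ≤ fstar + 2 * (L * r ^ 2)}`. In the theorem `r = √(Δ / L)`, so that
`L * r ^ 2 = Δ`. -/
structure SublevelSmooth (f : EuclideanSpace ℝ (Fin d) → ℝ) (fstar L r : ℝ)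
    (Q : Set (EuclideanSpace ℝ (Fin d))) : Prop where
  smoothOn : SmoothOn f L Q
  le_of_mem : ∀ x ∈ Q, fstar ≤ f x
  closedBall_subset : ∀ y, f y ≤ fstar + 2 * (L * r ^ 2) → Metric.closedBall y (r / 20) ⊆ Q

theorem mul_sqrt_div_sq {Δ : ℝ} (hL : 0 < L) (hΔ : 0 ≤ Δ) : L * √(Δ / L) ^ 2 = Δ := by
  rw [Real.sq_sqrt (by positivity), mul_div_cancel₀ _ hL.ne']

namespace SublevelSmooth

theorem of_region {Δ : ℝ} (hL : 0 < L) (hΔ : 0 ≤ Δ) (hf : SmoothOn f L (region f fstar L Δ))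
    (hle : ∀ x ∈ region f fstar L Δ, fstar ≤ f x) :
    SublevelSmooth f fstar L √(Δ / L) (region f fstar L Δ) where
  smoothOn := hf
  le_of_mem := hle
  closedBall_subset y hy x hx := by
    refine ⟨y, by rwa [mul_sqrt_div_sq hL hΔ] at hy, ?_⟩
    rwa [Metric.mem_closedBall, dist_eq_norm, Real.sqrt_div hΔ, div_div, mul_comm √L] at hx

theorem mem_of_le (h : SublevelSmooth f fstar L r Q) (hr : 0 ≤ r)
    (hx : f x ≤ fstar + 2 * (L * r ^ 2)) : x ∈ Q :=
  h.closedBall_subset x hx (Metric.mem_closedBall_self (by positivity))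

theorem isClosed_sublevel (h : SublevelSmooth f fstar L r Q) (hr : 0 < r) :
    IsClosed {x | f x ≤ fstar + 2 * (L * r ^ 2)} :=
  isClosed_sublevel_of_continuousAt (by positivity)
    (fun x hx => (h.smoothOn.differentiableAt x hx).continuousAt) h.closedBall_subset

theorem norm_gradient_sq_le (h : SublevelSmooth f fstar L r Q) (hL : 0 < L) (hr : 0 < r)
    (hx : f x ≤ fstar + 2 * (L * r ^ 2)) : ‖∇ f x‖ ^ 2 ≤ 2 * L * (f x - fstar) :=
  DPClippedSGD.norm_gradient_sq_le hL (by positivity) h.smoothOn.differentiableAt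
    h.smoothOn.lipschitz h.closedBall_subset h.le_of_mem hx

theorem norm_gradient_le (h : SublevelSmooth f fstar L r Q) (hL : 0 < L) (hr : 0 < r)
    (hx : f x ≤ fstar + 2 * (L * r ^ 2)) : ‖∇ f x‖ ≤ 2 * (L * r) := by
  refine (sq_le_sq₀ (norm_nonneg _) (by positivity)).1 ?_
  calc ‖∇ f x‖ ^ 2 ≤ 2 * L * (f x - fstar) := h.norm_gradient_sq_le hL hr hx
    _ ≤ 2 * L * (2 * (L * r ^ 2)) := by gcongr; linarith
    _ = (2 * (L * r)) ^ 2 := by ring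

end SublevelSmooth

theorem norm_add₃_sq_le {E : Type*} [SeminormedAddCommGroup E] (a b c : E) :
    ‖a + b + c‖ ^ 2 ≤ 3 * (‖a‖ ^ 2 + ‖b‖ ^ 2 + ‖c‖ ^ 2) := by
  have : ‖a + b + c‖ ^ 2 ≤ (‖a‖ + ‖b‖ + ‖c‖) ^ 2 := by
    gcongr
    exact norm_add₃_le
  nlinarith [sq_nonneg (‖a‖ - ‖b‖), sq_nonneg (‖a‖ - ‖c‖), sq_nonneg (‖b‖ - ‖c‖)]

namespace TunedStepsize

theorem inner_add_sq_le_stepError (h : TunedStepsize d K A s L r lam σw γ) :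
    inner ℝ G (-(γ • (clip lam g + w))) + L / 2 * ‖-(γ • (clip lam g + w))‖ ^ 2
      ≤ -(γ / 2 * ‖G‖ ^ 2) + stepError L γ lam G g w := by
  have hγ := h.γ_pos
  have hL := h.L_pos
  set X := clip lam g - G with hX
  have hsplit : clip lam g + w = G + X + w := by rw [hX]; abel
  have hinner : inner ℝ G (-(γ • (clip lam g + w)))
      = -γ * ‖G‖ ^ 2 + -γ * inner ℝ G X + -γ * inner ℝ G w := by
    rw [hsplit, inner_neg_right, inner_smul_right, inner_add_right, inner_add_right,
      real_inner_self_eq_norm_sq]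
    ring
  have hnorm : L / 2 * ‖-(γ • (clip lam g + w))‖ ^ 2
      ≤ L / 2 * (γ ^ 2 * (3 * (‖G‖ ^ 2 + ‖X‖ ^ 2 + ‖w‖ ^ 2))) := by
    rw [hsplit, norm_neg, norm_smul, Real.norm_of_nonneg hγ.le, mul_pow]
    gcongr
    exact norm_add₃_sq_le G X w
  have hsmooth : γ * L * (γ * ‖G‖ ^ 2) ≤ 1 / 600 * (γ * ‖G‖ ^ 2) := by
    gcongr
    exact h.smoothness
  have hG : 0 ≤ γ * ‖G‖ ^ 2 := by positivity
  have hX' : 0 ≤ L * γ ^ 2 * ‖X‖ ^ 2 := by positivity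
  have hw : 0 ≤ L * γ ^ 2 * ‖w‖ ^ 2 := by positivity
  rw [stepError, sampleError, noiseError, ← hX]
  linarith

theorem two_mul_le_stepError (h : TunedStepsize d K A s L r lam σw γ) (hG : ‖G‖ ≤ lam)
    (hGL : ‖G‖ ≤ 2 * (L * r)) (hw : r / 40 < γ * ‖w‖) :
    2 * (L * r ^ 2) ≤ stepError L γ lam G g w := by
  have hγ := h.γ_pos
  have hL := h.L_pos
  have hr := h.r_pos
  have hsample : -(L * r ^ 2) ≤ sampleError L γ lam G g := by
    refine neg_le_of_abs_le ((h.abs_sampleError_le hG hGL).trans ?_)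
    calc 4 * γ * L * r * ‖clip lam g - G‖ = 4 * (L * r) * (γ * ‖clip lam g - G‖) := by ring
      _ ≤ 4 * (L * r) * (r / 20) := by gcongr; exact h.mul_norm_clip_sub_le hG
      _ ≤ L * r ^ 2 := by nlinarith [mul_pos hL (pow_pos hr 2)]
  have hnoise : 3 * (L * r ^ 2) ≤ noiseError L γ G w := by
    have hinner : γ * inner ℝ G w ≤ γ * (2 * (L * r) * ‖w‖) := by
      gcongr
      exact (real_inner_le_norm _ _).trans (by gcongr)
    have hquad : 3 * r ^ 2 + 2 * r * (γ * ‖w‖) ≤ 10000 * (γ * ‖w‖) ^ 2 := by nlinarith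
    have := mul_le_mul_of_nonneg_left hquad hL.le
    rw [noiseError]
    linarith
  rw [stepError]
  linarith

theorem apply_step_le (h : TunedStepsize d K A s L r lam σw γ)
    (hf : SublevelSmooth f fstar L r Q) (hx : f x ≤ fstar + 2 * (L * r ^ 2))
    (hw : γ * ‖w‖ ≤ r / 40) :
    f (x - γ • (clip lam g + w))
      ≤ f x - γ / 2 * ‖∇ f x‖ ^ 2 + stepError L γ lam (∇ f x) g w := by
  have hlen : ‖γ • (clip lam g + w)‖ ≤ r / 20 := by
    rw [norm_smul, Real.norm_of_nonneg h.γ_pos.le]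
    have hsum : γ * ‖clip lam g + w‖ ≤ γ * (lam + ‖w‖) := mul_le_mul_of_nonneg_left
      ((norm_add_le _ _).trans (by gcongr; exact norm_clip_le h.lam_pos g)) h.γ_pos.le
    linarith [h.mul_lam_le]
  have hseg : segment ℝ x (x - γ • (clip lam g + w)) ⊆ Q :=
    ((convex_closedBall x (r / 20)).segment_subset
      (Metric.mem_closedBall_self (by linarith [h.r_pos]))
      (by rwa [Metric.mem_closedBall, dist_eq_norm, sub_sub_cancel_left, norm_neg])).trans
      (hf.closedBall_subset x hx)
  have hdescent := le_add_inner_add_sq_of_lipschitz_gradient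
    (fun z hz => hf.smoothOn.differentiableAt z (hseg hz))
    fun z hz => hf.smoothOn.lipschitz z (hseg hz) x (hseg (left_mem_segment ℝ _ _))
  rw [sub_sub_cancel_left] at hdescent
  linarith [h.inner_add_sq_le_stepError (G := ∇ f x) (g := g) (w := w)]

end TunedStepsize

end Descent

section RandomRecursion

variable {S E Ω : Type*} [MeasurableSpace S] [MeasurableSpace E] {Ψ : S × E → S}
  {η : ℕ → Ω → E} {X : ℕ → Ω → S} {s₀ : S}

theorem exists_measurable_eq_of_recursion (hΨ : Measurable Ψ) (hX0 : ∀ ω, X 0 ω = s₀)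
    (hX : ∀ k ω, X (k + 1) ω = Ψ (X k ω, η k ω)) (n : ℕ) :
    ∃ φ : (Finset.range n → E) → S, Measurable φ ∧ ∀ ω, X n ω = φ (fun j => η j ω) := by
  induction n with
  | zero => exact ⟨fun _ => s₀, measurable_const, hX0⟩
  | succ n ih =>
    obtain ⟨φ, hφ, hφX⟩ := ih
    have hsub : Finset.range n ⊆ Finset.range (n + 1) := Finset.range_mono n.le_succ
    exact ⟨fun y => Ψ (φ (fun j => y ⟨j, hsub j.2⟩), y ⟨n, Finset.self_mem_range_succ n⟩),
      by fun_prop, fun ω => by rw [hX, hφX]⟩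

variable [MeasurableSpace Ω] {P : Measure Ω}

theorem indepFun_of_recursion (hΨ : Measurable Ψ) (hη : ∀ k, Measurable (η k))
    (hind : iIndepFun η P) (hX0 : ∀ ω, X 0 ω = s₀)
    (hX : ∀ k ω, X (k + 1) ω = Ψ (X k ω, η k ω)) (n : ℕ) : IndepFun (X n) (η n) P := by
  obtain ⟨φ, hφ, hφX⟩ := exists_measurable_eq_of_recursion hΨ hX0 hX n
  rw [funext hφX]
  exact (hind.indepFun_finset (Finset.range n) {n} (by simp) hη).comp hφ
    (measurable_pi_apply (⟨n, by simp⟩ : ({n} : Finset ℕ)))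

theorem measurable_of_recursion (hΨ : Measurable Ψ) (hη : ∀ k, Measurable (η k))
    (hX0 : ∀ ω, X 0 ω = s₀) (hX : ∀ k ω, X (k + 1) ω = Ψ (X k ω, η k ω)) (n : ℕ) :
    Measurable (X n) := by
  induction n with
  | zero => rw [funext hX0]; exact measurable_const
  | succ n ih => rw [funext (hX n)]; exact hΨ.comp (ih.prodMk (hη n))

theorem lintegral_recursion_le [IsProbabilityMeasure P] (hΨ : Measurable Ψ)
    (hη : ∀ k, Measurable (η k)) (hind : iIndepFun η P) (hX0 : ∀ ω, X 0 ω = s₀)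
    (hX : ∀ k ω, X (k + 1) ω = Ψ (X k ω, η k ω)) {h : S → ℝ≥0∞} (hh : Measurable h) {q : ℝ≥0∞}
    (hstep : ∀ k s, ∫⁻ ω, h (Ψ (s, η k ω)) ∂P ≤ q * h s) (n : ℕ) :
    ∫⁻ ω, h (X n ω) ∂P ≤ q ^ n * h s₀ := by
  induction n with
  | zero => simp [hX0]
  | succ n ih =>
    have hXn := measurable_of_recursion hΨ hη hX0 hX n
    have hhΨ : Measurable fun p => h (Ψ p) := hh.comp hΨ
    have hindep := indepFun_of_recursion hΨ hη hind hX0 hX n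
    have := Measure.isProbabilityMeasure_map (μ := P) (hη n).aemeasurable
    calc ∫⁻ ω, h (X (n + 1) ω) ∂P = ∫⁻ ω, h (Ψ (X n ω, η n ω)) ∂P := by simp_rw [hX]
      _ = ∫⁻ p, h (Ψ p) ∂(P.map fun ω => (X n ω, η n ω)) :=
        (lintegral_map hhΨ (hXn.prodMk (hη n))).symm
      _ = ∫⁻ s, ∫⁻ e, h (Ψ (s, e)) ∂(P.map (η n)) ∂(P.map (X n)) := by
        rw [hindep.map_prod_eq_prod_map_map hXn.aemeasurable (hη n).aemeasurable,
          lintegral_prod _ hhΨ.aemeasurable]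
      _ ≤ ∫⁻ s, q * h s ∂(P.map (X n)) := lintegral_mono fun s =>
        (lintegral_map (hhΨ.comp measurable_prodMk_left) (hη n)).trans_le (hstep n s)
      _ = q * ∫⁻ ω, h (X n ω) ∂P := by
        rw [lintegral_const_mul _ hh, lintegral_map hh hXn]
      _ ≤ q * (q ^ n * h s₀) := by gcongr
      _ = q ^ (n + 1) * h s₀ := by rw [pow_succ', mul_assoc]

end RandomRecursion

section Trajectory

variable {d : ℕ} {Ξ : Type*} {F : Ξ → EuclideanSpace ℝ (Fin d) → ℝ}
  {f : EuclideanSpace ℝ (Fin d) → ℝ} {Q : Set (EuclideanSpace ℝ (Fin d))}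
  {fstar K A s L r lam σw γ : ℝ} {x₀ : EuclideanSpace ℝ (Fin d)}

/-- One step of the iteration on pairs of an iterate and its accumulated error, driven by a sample
and a noise vector. The accumulated error is frozen once it reaches `L * r ^ 2` or the iterate
leaves the sublevel set, so that its exponential moments can be bounded unconditionally. -/
noncomputable def trackedStep (F : Ξ → EuclideanSpace ℝ (Fin d) → ℝ)
    (f : EuclideanSpace ℝ (Fin d) → ℝ) (fstar L r γ lam : ℝ) :
    (EuclideanSpace ℝ (Fin d) × ℝ) × (Ξ × EuclideanSpace ℝ (Fin d)) →
      EuclideanSpace ℝ (Fin d) × ℝ := fun p =>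
  (p.1.1 - γ • (clip lam (∇ (F p.2.1) p.1.1) + p.2.2),
    if p.1.2 < L * r ^ 2 ∧ f p.1.1 ≤ fstar + 2 * (L * r ^ 2) then
      p.1.2 + stepError L γ lam (∇ f p.1.1) (∇ (F p.2.1) p.1.1) p.2.2 else p.1.2)

/-- The iterates, started from `x₀` with no error, together with their accumulated errors. -/
noncomputable def trackedIterate (F : Ξ → EuclideanSpace ℝ (Fin d) → ℝ)
    (f : EuclideanSpace ℝ (Fin d) → ℝ) (fstar L r γ lam : ℝ) (x₀ : EuclideanSpace ℝ (Fin d))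
    (e : ℕ → Ξ × EuclideanSpace ℝ (Fin d)) : ℕ → EuclideanSpace ℝ (Fin d) × ℝ
  | 0 => (x₀, 0)
  | k + 1 => trackedStep F f fstar L r γ lam (trackedIterate F f fstar L r γ lam x₀ e k, e k)

theorem fst_trackedIterate (e : ℕ → Ξ × EuclideanSpace ℝ (Fin d)) (k : ℕ) :
    (trackedIterate F f fstar L r γ lam x₀ e k).1
      = iterate F γ lam x₀ (fun k => (e k).1) (fun k => (e k).2) k := by
  induction k with
  | zero => rfl
  | succ k ih => rw [trackedIterate, iterate, ← ih]; rfl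

theorem snd_lt_of_snd_trackedStep_lt
    {p : (EuclideanSpace ℝ (Fin d) × ℝ) × (Ξ × EuclideanSpace ℝ (Fin d))}
    (hp : (trackedStep F f fstar L r γ lam p).2 < L * r ^ 2) : p.1.2 < L * r ^ 2 := by
  by_contra hfrozen
  rw [trackedStep, if_neg fun hactive => hfrozen hactive.1] at hp
  exact hfrozen hp

theorem snd_trackedIterate_lt_of_le {e : ℕ → Ξ × EuclideanSpace ℝ (Fin d)} {k n : ℕ} (hk : k ≤ n)
    (hn : (trackedIterate F f fstar L r γ lam x₀ e n).2 < L * r ^ 2) :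
    (trackedIterate F f fstar L r γ lam x₀ e k).2 < L * r ^ 2 := by
  induction n, hk using Nat.le_induction with
  | base => exact hn
  | succ n _ ih => exact ih (snd_lt_of_snd_trackedStep_lt hn)

namespace TunedStepsize

theorem apply_fst_trackedStep_le (h : TunedStepsize d K A s L r lam σw γ)
    (hf : SublevelSmooth f fstar L r Q) (hlam : 2 * (L * r) ≤ lam)
    {p : (EuclideanSpace ℝ (Fin d) × ℝ) × (Ξ × EuclideanSpace ℝ (Fin d))}
    (hx : f p.1.1 ≤ fstar + 2 * (L * r ^ 2)) (hV : -(L * r ^ 2) ≤ p.1.2)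
    (hV' : (trackedStep F f fstar L r γ lam p).2 < L * r ^ 2) :
    f (trackedStep F f fstar L r γ lam p).1 + γ / 2 * ‖∇ f p.1.1‖ ^ 2
      ≤ f p.1.1 + ((trackedStep F f fstar L r γ lam p).2 - p.1.2) := by
  have hactive : p.1.2 < L * r ^ 2 ∧ f p.1.1 ≤ fstar + 2 * (L * r ^ 2) :=
    ⟨snd_lt_of_snd_trackedStep_lt hV', hx⟩
  simp only [trackedStep, if_pos hactive] at hV' ⊢
  have hGL := hf.norm_gradient_le h.L_pos h.r_pos hx
  -- A step with large noise would raise the accumulated error by `2 * (L * r ^ 2)`.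
  have hsmall : γ * ‖p.2.2‖ ≤ r / 40 := by
    by_contra! hlarge
    linarith [h.two_mul_le_stepError (g := ∇ (F p.2.1) p.1.1) (hGL.trans hlam) hGL hlarge]
  linarith [h.apply_step_le hf hx hsmall (g := ∇ (F p.2.1) p.1.1)]

theorem apply_trackedIterate_add_sum_le (h : TunedStepsize d K A s L r lam σw γ)
    (hf : SublevelSmooth f fstar L r Q) (hlam : 2 * (L * r) ≤ lam)
    (hx₀ : f x₀ - fstar ≤ L * r ^ 2) {e : ℕ → Ξ × EuclideanSpace ℝ (Fin d)} {k : ℕ}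
    (hk : (trackedIterate F f fstar L r γ lam x₀ e k).2 < L * r ^ 2) :
    f (trackedIterate F f fstar L r γ lam x₀ e k).1 + γ / 2 * ∑ j ∈ Finset.range k,
        ‖∇ f (trackedIterate F f fstar L r γ lam x₀ e j).1‖ ^ 2
      ≤ f x₀ + (trackedIterate F f fstar L r γ lam x₀ e k).2 := by
  have hγ := h.γ_pos
  induction k with
  | zero => simp [trackedIterate]
  | succ k ih =>
    have hbound := ih (snd_lt_of_snd_trackedStep_lt hk)
    have hVk := snd_trackedIterate_lt_of_le k.le_succ hk
    have hsum : 0 ≤ γ / 2 * ∑ j ∈ Finset.range k,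
        ‖∇ f (trackedIterate F f fstar L r γ lam x₀ e j).1‖ ^ 2 := by positivity
    have hx : f (trackedIterate F f fstar L r γ lam x₀ e k).1 ≤ fstar + 2 * (L * r ^ 2) := by
      linarith
    have hlower := hf.le_of_mem _ (hf.mem_of_le h.r_pos.le hx)
    have hstep := h.apply_fst_trackedStep_le hf hlam hx (by dsimp only; linarith) hk
    rw [Finset.sum_range_succ, trackedIterate]
    linarith

theorem iInf_norm_gradient_sq_le {n : ℕ} (h : TunedStepsize d n A s L r lam σw γ)
    (hf : SublevelSmooth f fstar L r Q) (hlam : 2 * (L * r) ≤ lam)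
    (hx₀ : f x₀ - fstar ≤ L * r ^ 2) {e : ℕ → Ξ × EuclideanSpace ℝ (Fin d)}
    (hn : (trackedIterate F f fstar L r γ lam x₀ e n).2 < L * r ^ 2) :
    ⨅ t : Fin (n + 1), ‖∇ f (trackedIterate F f fstar L r γ lam x₀ e t).1‖ ^ 2
      ≤ 4 * (L * r ^ 2) / (γ * n) := by
  have hγ := h.γ_pos
  have hn0 := h.K_pos
  set X := trackedIterate F f fstar L r γ lam x₀ e
  have hbound := h.apply_trackedIterate_add_sum_le hf hlam hx₀ hn
  have hsum : n * ⨅ t : Fin (n + 1), ‖∇ f (X t).1‖ ^ 2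
      ≤ ∑ j ∈ Finset.range n, ‖∇ f (X j).1‖ ^ 2 := by
    rw [← nsmul_eq_mul]
    nth_rewrite 1 [← Finset.card_range n]
    refine Finset.card_nsmul_le_sum _ _ _ fun j hj => ?_
    exact ciInf_le (f := fun t : Fin (n + 1) => ‖∇ f (X t).1‖ ^ 2) (Set.finite_range _).bddBelow
      ⟨j, (Finset.mem_range.1 hj).trans n.lt_succ_self⟩
  have hnonneg : 0 ≤ γ / 2 * ∑ j ∈ Finset.range n, ‖∇ f (X j).1‖ ^ 2 := by positivity
  have hlower := hf.le_of_mem (X n).1 (hf.mem_of_le h.r_pos.le (by linarith))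
  have hscaled := mul_le_mul_of_nonneg_left hsum (by positivity : 0 ≤ γ / 2)
  rw [le_div_iff₀ (by positivity)]
  linarith

end TunedStepsize

theorem SublevelSmooth.iInf_norm_gradient_sq_le (hf : SublevelSmooth f fstar L r Q) (hL : 0 < L)
    (hr : 0 < r) (hx₀ : f x₀ - fstar ≤ L * r ^ 2) {ξ : ℕ → Ξ} {w : ℕ → EuclideanSpace ℝ (Fin d)}
    {n : ℕ} : ⨅ t : Fin (n + 1), ‖∇ f (iterate F γ lam x₀ ξ w t)‖ ^ 2 ≤ 2 * L * (L * r ^ 2) :=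
  calc ⨅ t : Fin (n + 1), ‖∇ f (iterate F γ lam x₀ ξ w t)‖ ^ 2
    _ ≤ ‖∇ f x₀‖ ^ 2 :=
        ciInf_le (f := fun t : Fin (n + 1) => ‖∇ f (iterate F γ lam x₀ ξ w t)‖ ^ 2)
          (Set.finite_range _).bddBelow 0
    _ ≤ 2 * L * (f x₀ - fstar) :=
        hf.norm_gradient_sq_le hL hr (by linarith [show 0 ≤ L * r ^ 2 by positivity])
    _ ≤ 2 * L * (L * r ^ 2) := by gcongr

end Trajectory

section HighProbability

variable {d : ℕ} {Ξ Ω : Type*} [MeasurableSpace Ξ] [MeasurableSpace Ω] {D : Measure Ξ}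
  {F : Ξ → EuclideanSpace ℝ (Fin d) → ℝ} {f : EuclideanSpace ℝ (Fin d) → ℝ}
  {Q : Set (EuclideanSpace ℝ (Fin d))} {P : Measure Ω} {ξ : ℕ → Ω → Ξ}
  {w : ℕ → Ω → EuclideanSpace ℝ (Fin d)} {fstar K A s L r lam σ σw α γ : ℝ}
  {x x₀ : EuclideanSpace ℝ (Fin d)}

/-- The steps of the method use independent pairs of a sample `ξ k ∼ D` and a noise vector
`w k ∼ N(0, σw² I)`. The two members of a pair may depend on each other. -/
structure IndependentSteps (P : Measure Ω) (D : Measure Ξ) (σw : ℝ) (ξ : ℕ → Ω → Ξ)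
    (w : ℕ → Ω → EuclideanSpace ℝ (Fin d)) : Prop where
  measurable_sample : ∀ k, Measurable (ξ k)
  measurable_noise : ∀ k, Measurable (w k)
  law_sample : ∀ k, P.map (ξ k) = D
  law_noise : ∀ k, P.map (w k) = noiseLaw (Fin d) σw
  indep : iIndepFun (fun k ω => (ξ k ω, w k ω)) P

theorem FreshSamples.independentSteps (h : FreshSamples P D σw ξ w) :
    IndependentSteps P D σw ξ w where
  measurable_sample := h.measurable_sample
  measurable_noise := h.measurable_noise
  law_sample := h.law_sample
  law_noise := h.law_noise
  indep := h.indep_steps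

theorem measurable_stepError {G g v : Ω → EuclideanSpace ℝ (Fin d)} (hG : Measurable G)
    (hg : Measurable g) (hv : Measurable v) :
    Measurable fun ω => stepError L γ lam (G ω) (g ω) (v ω) := by
  unfold stepError sampleError noiseError
  fun_prop

theorem measurable_trackedStep
    (hF : Measurable fun p : Ξ × EuclideanSpace ℝ (Fin d) => ∇ (F p.1) p.2)
    (hf : MeasurableSet {x | f x ≤ fstar + 2 * (L * r ^ 2)}) :
    Measurable (trackedStep F f fstar L r γ lam) := by
  have hsample : Measurable fun p : (EuclideanSpace ℝ (Fin d) × ℝ) ×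
      (Ξ × EuclideanSpace ℝ (Fin d)) => ∇ (F p.2.1) p.1.1 :=
    hF.comp (measurable_snd.fst.prodMk measurable_fst.fst)
  have herror : Measurable fun p : (EuclideanSpace ℝ (Fin d) × ℝ) ×
      (Ξ × EuclideanSpace ℝ (Fin d)) =>
        stepError L γ lam (∇ f p.1.1) (∇ (F p.2.1) p.1.1) p.2.2 :=
    measurable_stepError ((measurable_gradient f).comp measurable_fst.fst) hsample
      measurable_snd.snd
  have hactive : MeasurableSet {p : (EuclideanSpace ℝ (Fin d) × ℝ) ×
      (Ξ × EuclideanSpace ℝ (Fin d)) |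
        p.1.2 < L * r ^ 2 ∧ f p.1.1 ≤ fstar + 2 * (L * r ^ 2)} :=
    (measurableSet_lt measurable_fst.snd measurable_const).inter (hf.preimage measurable_fst.fst)
  unfold trackedStep
  refine Measurable.prodMk (by fun_prop) ?_
  exact Measurable.ite hactive (measurable_fst.snd.add herror) measurable_fst.snd

namespace TunedStepsize

theorem lintegral_exp_stepError_le [IsProbabilityMeasure D]
    (h : TunedStepsize d K A s L r lam σw γ)
    (hF : StochasticObjective D F) (hO : HeavyTailedOracleOn D F α σ Q)
    (hS : IndependentSteps P D σw ξ w) (hα : 1 ≤ α) (hα2 : α ≤ 2) (hσ : σ ^ α ≤ s * lam ^ α)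
    (hx : x ∈ Q) (hG : ‖∇ (expectedLoss D F) x‖ ≤ 2 * lam / 3)
    (hGL : ‖∇ (expectedLoss D F) x‖ ≤ 2 * (L * r)) (k : ℕ) :
    ∫⁻ ω, ENNReal.ofReal (Real.exp (2 * A / (L * r ^ 2) *
        stepError L γ lam (∇ (expectedLoss D F) x) (∇ (F (ξ k ω)) x) (w k ω))) ∂P
      ≤ ENNReal.ofReal (Real.exp (A / K)) := by
  set G := ∇ (expectedLoss D F) x
  have hξ := hS.measurable_sample k
  have hw := hS.measurable_noise k
  have hgrad : Measurable fun i => ∇ (F i) x := hF.measurable_gradient.comp measurable_prodMk_right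
  have hdouble : ∀ y, 2 * (2 * A / (L * r ^ 2) * y) = 4 * A / (L * r ^ 2) * y := fun y => by ring
  have hsample : Measurable fun i => sampleError L γ lam G (∇ (F i) x) := by
    unfold sampleError
    fun_prop
  have hnoise : Measurable fun v => noiseError L γ G v := by
    unfold noiseError
    fun_prop
  have hsampleξ : Measurable fun ω => sampleError L γ lam G (∇ (F (ξ k ω)) x) := hsample.comp hξ
  simp_rw [stepError, mul_add]
  refine lintegral_exp_add_le (hsampleξ.const_mul _).aemeasurable ?_ ?_ <;> simp_rw [hdouble]
  · rw [← lintegral_map (μ := P) (g := ξ k) (f := fun i => ENNReal.ofReal (Real.exp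
      (4 * A / (L * r ^ 2) * sampleError L γ lam G (∇ (F i) x)))) (by fun_prop) hξ,
      hS.law_sample k]
    exact h.lintegral_exp_sampleError_le (hO.integrable x hx) (hO.unbiased x hx)
      (hO.integrable_moment x hx) ((hO.moment_le x hx).trans hσ) hα hα2 hG hGL
  · rw [← lintegral_map (μ := P) (g := w k) (f := fun v => ENNReal.ofReal (Real.exp
      (4 * A / (L * r ^ 2) * noiseError L γ G v))) (by fun_prop) hw, hS.law_noise k]
    exact h.lintegral_exp_noiseError_le hGL

theorem lintegral_exp_snd_trackedStep_le [IsProbabilityMeasure P] [IsProbabilityMeasure D]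
    (h : TunedStepsize d K A s L r lam σw γ) (hf : SublevelSmooth (expectedLoss D F) fstar L r Q)
    (hF : StochasticObjective D F) (hO : HeavyTailedOracleOn D F α σ Q)
    (hS : IndependentSteps P D σw ξ w) (hα : 1 ≤ α) (hα2 : α ≤ 2) (hσ : σ ^ α ≤ s * lam ^ α)
    (hlam : 3 * (L * r) ≤ lam) (k : ℕ) (p : EuclideanSpace ℝ (Fin d) × ℝ) :
    ∫⁻ ω, ENNReal.ofReal (Real.exp (2 * A / (L * r ^ 2) *
        (trackedStep F (expectedLoss D F) fstar L r γ lam (p, (ξ k ω, w k ω))).2)) ∂P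
      ≤ ENNReal.ofReal (Real.exp (A / K))
        * ENNReal.ofReal (Real.exp (2 * A / (L * r ^ 2) * p.2)) := by
  by_cases hactive : p.2 < L * r ^ 2 ∧ expectedLoss D F p.1 ≤ fstar + 2 * (L * r ^ 2)
  · have hGL := hf.norm_gradient_le h.L_pos h.r_pos hactive.2
    simp only [trackedStep, if_pos hactive]
    simp_rw [mul_add, Real.exp_add, ENNReal.ofReal_mul (Real.exp_pos _).le]
    rw [lintegral_const_mul' _ _ ENNReal.ofReal_ne_top, mul_comm]
    gcongr
    exact h.lintegral_exp_stepError_le hF hO hS hα hα2 hσ (hf.mem_of_le h.r_pos.le hactive.2)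
      (by linarith) hGL k
  · simp only [trackedStep, if_neg hactive, lintegral_const, measure_univ, mul_one]
    refine le_mul_of_one_le_left zero_le (ENNReal.one_le_ofReal.2 (Real.one_le_exp ?_))
    exact div_nonneg h.A_pos.le h.K_pos.le

end TunedStepsize

theorem measure_le_of_lintegral_exp_le {V : Ω → ℝ} (hV : AEMeasurable V P) {a b A : ℝ} (ha : 0 ≤ a)
    (hle : ∫⁻ ω, ENNReal.ofReal (Real.exp (a * V ω)) ∂P ≤ ENNReal.ofReal (Real.exp A)) :
    P {ω | b ≤ V ω} ≤ ENNReal.ofReal (Real.exp (A - a * b)) := by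
  have hmarkov := (mul_meas_ge_le_lintegral₀ (μ := P)
    (f := fun ω => ENNReal.ofReal (Real.exp (a * V ω))) (by fun_prop)
    (ENNReal.ofReal (Real.exp (a * b)))).trans hle
  rw [Real.exp_sub, ENNReal.ofReal_div_of_pos (Real.exp_pos _),
    ENNReal.le_div_iff_mul_le (by simp [Real.exp_pos]) (by simp), mul_comm]
  refine (mul_le_mul_right (measure_mono fun ω hω => ?_) _).trans hmarkov
  exact ENNReal.ofReal_le_ofReal (Real.exp_le_exp.2 (mul_le_mul_of_nonneg_left hω ha))

namespace TunedStepsize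

theorem measure_le_snd_trackedIterate_le [IsProbabilityMeasure P] [IsProbabilityMeasure D] {n : ℕ}
    (h : TunedStepsize d n A s L r lam σw γ) (hf : SublevelSmooth (expectedLoss D F) fstar L r Q)
    (hF : StochasticObjective D F) (hO : HeavyTailedOracleOn D F α σ Q)
    (hS : IndependentSteps P D σw ξ w) (hα : 1 ≤ α) (hα2 : α ≤ 2) (hσ : σ ^ α ≤ s * lam ^ α)
    (hlam : 3 * (L * r) ≤ lam) :
    P {ω | L * r ^ 2 ≤ (trackedIterate F (expectedLoss D F) fstar L r γ lam x₀
        (fun k => (ξ k ω, w k ω)) n).2} ≤ ENNReal.ofReal (Real.exp (-A)) := by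
  have hL := h.L_pos
  have hr := h.r_pos
  have hA := h.A_pos
  have hn := h.K_pos
  have hΨ : Measurable (trackedStep F (expectedLoss D F) fstar L r γ lam) :=
    measurable_trackedStep hF.measurable_gradient (hf.isClosed_sublevel hr).measurableSet
  have hη : ∀ k, Measurable fun ω => (ξ k ω, w k ω) := fun k =>
    (hS.measurable_sample k).prodMk (hS.measurable_noise k)
  set X : ℕ → Ω → EuclideanSpace ℝ (Fin d) × ℝ := fun k ω =>
    trackedIterate F (expectedLoss D F) fstar L r γ lam x₀ (fun k => (ξ k ω, w k ω)) k
  have hexp := lintegral_recursion_le (X := X) (s₀ := (x₀, 0)) hΨ hη hS.indep (fun _ => rfl)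
    (fun _ _ => rfl) (h := fun p => ENNReal.ofReal (Real.exp (2 * A / (L * r ^ 2) * p.2)))
    (by fun_prop) (h.lintegral_exp_snd_trackedStep_le hf hF hO hS hα hα2 hσ hlam) n
  rw [mul_zero, Real.exp_zero, ENNReal.ofReal_one, mul_one,
    ← ENNReal.ofReal_pow (Real.exp_pos _).le, ← Real.exp_nat_mul, mul_div_cancel₀ _ hn.ne'] at hexp
  have hXn := measurable_of_recursion (X := X) (s₀ := (x₀, 0)) hΨ hη (fun _ => rfl)
    (fun _ _ => rfl) n
  refine (measure_le_of_lintegral_exp_le hXn.snd.aemeasurable (by positivity) hexp).trans_eq ?_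
  rw [div_mul_cancel₀ _ (by positivity)]
  ring_nf

theorem one_sub_le_measure_iInf_norm_gradient_sq_le [IsProbabilityMeasure P]
    [IsProbabilityMeasure D] {n : ℕ} (h : TunedStepsize d n A s L r lam σw γ)
    (hf : SublevelSmooth (expectedLoss D F) fstar L r Q) (hF : StochasticObjective D F)
    (hO : HeavyTailedOracleOn D F α σ Q) (hS : IndependentSteps P D σw ξ w) (hα : 1 ≤ α)
    (hα2 : α ≤ 2) (hσ : σ ^ α ≤ s * lam ^ α) (hlam : 3 * (L * r) ≤ lam)
    (hx₀ : expectedLoss D F x₀ - fstar ≤ L * r ^ 2) :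
    1 - ENNReal.ofReal (Real.exp (-A)) ≤ P {ω | ⨅ t : Fin (n + 1),
      ‖∇ (expectedLoss D F) (iterate F γ lam x₀ (fun k => ξ k ω) (fun k => w k ω) t)‖ ^ 2
        ≤ 4 * (L * r ^ 2) / (γ * n)} := by
  have hLr : 2 * (L * r) ≤ lam := by linarith [mul_pos h.L_pos h.r_pos]
  refine tsub_le_iff_left.2 ?_
  rw [← measure_univ (μ := P)]
  refine (measure_mono fun ω _ => ?_).trans ((measure_union_le _ _).trans (add_le_add_left
    (h.measure_le_snd_trackedIterate_le (x₀ := x₀) hf hF hO hS hα hα2 hσ hlam) _))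
  refine or_iff_not_imp_left.2 fun hsmall => ?_
  simpa only [fst_trackedIterate, Set.mem_ofPred_eq] using
    h.iInf_norm_gradient_sq_le hf hLr hx₀ (not_le.1 hsmall)

end TunedStepsize

end HighProbability

section StepsizeMin

variable {d K : ℕ} {α σ σw L Δ lam β m a b : ℝ}

theorem ofReal_le_ofReal_div_ofReal_iff (ha : 0 < a) (hm : 0 ≤ m) :
    ENNReal.ofReal m ≤ ENNReal.ofReal a / ENNReal.ofReal b ↔ m * b ≤ a := by
  rw [ENNReal.le_div_iff_mul_le (.inr (ENNReal.ofReal_pos.2 ha).ne') (.inl ENNReal.ofReal_ne_top),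
    ← ENNReal.ofReal_mul hm, ENNReal.ofReal_le_ofReal_iff ha.le]

theorem ofReal_div_ofReal_le_ofReal_iff (ha : 0 < a) (hm : 0 ≤ m) :
    ENNReal.ofReal a / ENNReal.ofReal b ≤ ENNReal.ofReal m ↔ a ≤ m * b := by
  rw [ENNReal.div_le_iff_le_mul (.inr ENNReal.ofReal_ne_top) (.inl ENNReal.ofReal_ne_top),
    ← ENNReal.ofReal_mul hm, ENNReal.ofReal_le_ofReal_iff', or_iff_left ha.not_ge]

theorem le_stepsizeMin_iff (hL : 0 < L) (hΔ : 0 < Δ) (hlam : 0 < lam) (hm : 0 ≤ m) :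
    m ≤ stepsizeMin d K α σ σw L Δ lam β ↔ m ≤ 1 / L ∧
      m * (lam ^ (1 - α / 2) * √(K * Real.log (K / β) * noiseLevel α σ L Δ lam)) ≤ √(Δ / L) ∧
      m * (K * noiseLevel α σ L Δ lam * biasFactor α σ L Δ lam) ≤ √(Δ / L) * lam ^ (α - 1) ∧
      m * (σw * √(d * K * Real.log (K / β))) ≤ √(Δ / L) := by
  have hr : 0 < √(Δ / L) := by positivity
  have hp : 0 < lam ^ (α - 1) := by positivity
  rw [stepsizeMin, ← ENNReal.ofReal_le_iff_le_toReal
    (ne_top_of_le_ne_top ENNReal.ofReal_ne_top (min_le_left _ _)), le_min_iff, le_min_iff,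
    le_min_iff, ENNReal.ofReal_le_ofReal_iff (by positivity),
    ofReal_le_ofReal_div_ofReal_iff hr hm, ofReal_le_ofReal_div_ofReal_iff (mul_pos hr hp) hm,
    ofReal_le_ofReal_div_ofReal_iff hr hm]

theorem stepsizeMin_le_iff (hL : 0 < L) (hΔ : 0 < Δ) (hlam : 0 < lam) (hm : 0 ≤ m) :
    stepsizeMin d K α σ σw L Δ lam β ≤ m ↔ 1 / L ≤ m ∨
      √(Δ / L) ≤ m * (lam ^ (1 - α / 2) * √(K * Real.log (K / β) * noiseLevel α σ L Δ lam)) ∨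
      √(Δ / L) * lam ^ (α - 1) ≤ m * (K * noiseLevel α σ L Δ lam * biasFactor α σ L Δ lam) ∨
      √(Δ / L) ≤ m * (σw * √(d * K * Real.log (K / β))) := by
  have hr : 0 < √(Δ / L) := by positivity
  have hp : 0 < lam ^ (α - 1) := by positivity
  rw [stepsizeMin, ← ENNReal.le_ofReal_iff_toReal_le
    (ne_top_of_le_ne_top ENNReal.ofReal_ne_top (min_le_left _ _)) hm, min_le_iff, min_le_iff,
    min_le_iff, ENNReal.ofReal_le_ofReal_iff hm, ofReal_div_ofReal_le_ofReal_iff hr hm,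
    ofReal_div_ofReal_le_ofReal_iff (mul_pos hr hp) hm, ofReal_div_ofReal_le_ofReal_iff hr hm]

theorem stepsizeMin_pos (hL : 0 < L) (hΔ : 0 < Δ) (hlam : 0 < lam) :
    0 < stepsizeMin d K α σ σw L Δ lam β := by
  have hr : 0 < √(Δ / L) := by positivity
  have hp : 0 < √(Δ / L) * lam ^ (α - 1) := by positivity
  rw [← not_le, stepsizeMin_le_iff hL hΔ hlam le_rfl]
  simp only [zero_mul, hr.not_ge, hp.not_ge, (one_div_pos.2 hL).not_ge, or_self, not_false_iff]

end StepsizeMin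

section NoiseLevel

variable {α σ L Δ lam : ℝ}

theorem zeta_nonneg : 0 ≤ zeta L Δ lam := le_max_left _ _

theorem noiseLevel_pos (hσ : 0 < σ) : 0 < noiseLevel α σ L Δ lam :=
  add_pos_of_pos_of_nonneg (Real.rpow_pos_of_pos hσ _) (Real.rpow_nonneg zeta_nonneg _)

theorem rpow_le_noiseLevel_div_mul (hlam : 0 < lam) :
    σ ^ α ≤ noiseLevel α σ L Δ lam / lam ^ α * lam ^ α := by
  rw [div_mul_cancel₀ _ (Real.rpow_pos_of_pos hlam _).ne']
  exact le_add_of_nonneg_right (Real.rpow_nonneg zeta_nonneg _)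

theorem mul_noiseLevel_rpow_eq_one (hσ : 0 < σ) (hα : α ≠ 0) (hζ : zeta L Δ lam = 0) :
    σ * noiseLevel α σ L Δ lam ^ (-1 / α) = 1 := by
  rw [noiseLevel, hζ, Real.zero_rpow hα, add_zero, ← Real.rpow_mul hσ.le, mul_div_cancel₀ _ hα,
    Real.rpow_neg_one, mul_inv_cancel₀ hσ.ne']

theorem quarter_le_biasFactor (hσ : 0 < σ) (hα : α ≠ 0) (hlam : 0 < lam) :
    1 / 4 ≤ biasFactor α σ L Δ lam := by
  have hS := noiseLevel_pos (α := α) (L := L) (Δ := Δ) (lam := lam) hσ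
  have hζ := zeta_nonneg (L := L) (Δ := Δ) (lam := lam)
  have hclip : 0 ≤ lam ^ (α - 1) * zeta L Δ lam / noiseLevel α σ L Δ lam := by positivity
  unfold biasFactor
  rcases le_or_gt (2 * √(L * Δ) - lam / 2) 0 with hsmall | hlarge
  · have hgrad : 0 ≤ √(L * Δ) / lam := by positivity
    linarith [mul_noiseLevel_rpow_eq_one hσ hα (max_eq_left hsmall)]
  · have hgrad : 1 / 4 ≤ √(L * Δ) / lam := by
      rw [le_div_iff₀ hlam]
      linarith
    have hnoise : 0 ≤ σ * noiseLevel α σ L Δ lam ^ (-1 / α) := by positivity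
    linarith

theorem zeta_le_mul_biasFactor (hσ : 0 < σ) (hlam : 0 < lam) :
    lam ^ (α - 1) * zeta L Δ lam ≤ noiseLevel α σ L Δ lam * biasFactor α σ L Δ lam := by
  have hS := noiseLevel_pos (α := α) (L := L) (Δ := Δ) (lam := lam) hσ
  rw [← div_le_iff₀' hS, biasFactor, add_right_comm]
  exact le_add_of_nonneg_left (by positivity)

end NoiseLevel

section ErrorBound

variable {d K : ℕ} {α σ σw L Δ lam β q m : ℝ}

/-- The right-hand side of the convergence guarantee without its constant: the largest of the
optimization, stochastic, clipping-bias and privacy-noise terms. -/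
noncomputable def errorBound (d K : ℕ) (α σ σw L Δ lam β : ℝ) : ℝ :=
  max (max (optimizationTerm K L Δ lam) (stochasticTerm K α σ L Δ lam β))
    (max (clippingBiasTerm α σ L Δ lam) (dpTerm d K σw L Δ lam β))

theorem optimizationTerm_le_errorBound :
    optimizationTerm K L Δ lam ≤ errorBound d K α σ σw L Δ lam β :=
  (le_max_left _ _).trans (le_max_left _ _)

theorem stochasticTerm_le_errorBound :
    stochasticTerm K α σ L Δ lam β ≤ errorBound d K α σ σw L Δ lam β :=
  (le_max_right _ _).trans (le_max_left _ _)

theorem clippingBiasTerm_le_errorBound :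
    clippingBiasTerm α σ L Δ lam ≤ errorBound d K α σ σw L Δ lam β :=
  (le_max_left _ _).trans (le_max_right _ _)

theorem dpTerm_le_errorBound : dpTerm d K σw L Δ lam β ≤ errorBound d K α σ σw L Δ lam β :=
  (le_max_right _ _).trans (le_max_right _ _)

theorem div_le_optimizationTerm : L * Δ / K ≤ optimizationTerm K L Δ lam :=
  le_add_of_nonneg_right (by positivity)

theorem le_stochasticTerm (hσ : 0 < σ) (hL : 0 ≤ L) (hΔ : 0 ≤ Δ) (hlam : 0 < lam)
    (hA : 0 ≤ Real.log (K / β)) :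
    √(L * Δ) * (lam ^ (1 - α / 2) * √(K * Real.log (K / β) * noiseLevel α σ L Δ lam)) / K
      ≤ stochasticTerm K α σ L Δ lam β := by
  have hS := noiseLevel_pos (α := α) (L := L) (Δ := Δ) (lam := lam) hσ
  refine le_add_of_le_of_nonneg (le_of_eq ?_) (by positivity)
  rcases K.eq_zero_or_pos with rfl | hK
  · simp
  rw [show K * Real.log (K / β) * noiseLevel α σ L Δ lam
      = (K : ℝ) ^ 2 * (noiseLevel α σ L Δ lam * Real.log (K / β) / K) by field_simp,
    Real.sqrt_mul (sq_nonneg (K : ℝ)), Real.sqrt_sq (by positivity)]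
  field_simp

theorem le_clippingBiasTerm (hL : 0 ≤ L) (hΔ : 0 ≤ Δ) (hlam : 0 ≤ lam) :
    √(L * Δ) * (noiseLevel α σ L Δ lam * biasFactor α σ L Δ lam / lam ^ (α - 1))
      ≤ clippingBiasTerm α σ L Δ lam := by
  refine le_add_of_le_of_nonneg (le_of_eq ?_) (by positivity)
  ring

theorem le_dpTerm (hL : 0 ≤ L) (hΔ : 0 ≤ Δ) (hA : 0 ≤ Real.log (K / β)) :
    √(L * Δ) * (σw * √(d * K * Real.log (K / β))) / K ≤ dpTerm d K σw L Δ lam β := by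
  refine le_add_of_le_of_nonneg (le_of_eq ?_) (by positivity)
  have hsqrt : √(L * Δ) * √(d * K * Real.log (K / β)) = √(d * L * Δ * Real.log (K / β)) * √K := by
    rw [← Real.sqrt_mul (by positivity), ← Real.sqrt_mul (by positivity)]
    ring_nf
  calc √(L * Δ) * (σw * √(d * K * Real.log (K / β))) / K
      = σw * √(d * L * Δ * Real.log (K / β)) * (√K / K) := by rw [mul_left_comm, hsqrt]; ring
    _ = σw * √(d * L * Δ * Real.log (K / β)) / √K := by
        rw [Real.sqrt_div_self, ← div_eq_mul_inv]

theorem mul_sqrt_div (hL : 0 < L) : L * √(Δ / L) = √(L * Δ) := by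
  rw [show L * Δ = L ^ 2 * (Δ / L) by field_simp, Real.sqrt_mul (sq_nonneg L), Real.sqrt_sq hL.le]

theorem div_mul_le_of_sqrt_le_mul (hL : 0 < L) (hΔ : 0 ≤ Δ) (hm : 0 < m) (hq : √(Δ / L) ≤ m * q)
    (K : ℕ) : Δ / (m * K) ≤ √(L * Δ) * q / K := by
  have hsqrt : √(L * Δ) * √(Δ / L) = Δ := by
    rw [← mul_sqrt_div hL, mul_assoc, ← sq, mul_sqrt_div_sq hL hΔ]
  rw [← div_div]
  gcongr
  rw [div_le_iff₀' hm]
  calc Δ = √(L * Δ) * √(Δ / L) := hsqrt.symm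
    _ ≤ √(L * Δ) * (m * q) := by gcongr
    _ = m * (√(L * Δ) * q) := by ring

theorem div_stepsizeMin_le_errorBound (hσ : 0 < σ) (hL : 0 < L) (hΔ : 0 < Δ) (hlam : 0 < lam)
    (hK : 1 ≤ K) (hA : 0 ≤ Real.log (K / β)) :
    Δ / (stepsizeMin d K α σ σw L Δ lam β * K) ≤ errorBound d K α σ σw L Δ lam β := by
  have hm := stepsizeMin_pos (d := d) (K := K) (α := α) (σ := σ) (σw := σw) (β := β) hL hΔ hlam
  have hp : 0 < lam ^ (α - 1) := by positivity
  rcases (stepsizeMin_le_iff hL hΔ hlam hm.le).1 le_rfl with htight | htight | htight | htight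
  · refine le_trans ?_ (div_le_optimizationTerm.trans optimizationTerm_le_errorBound)
    rw [← div_div]
    gcongr
    rwa [div_le_iff₀ hm, mul_right_comm, le_mul_iff_one_le_left hΔ, ← div_le_iff₀' hL]
  · exact (div_mul_le_of_sqrt_le_mul hL hΔ.le hm htight K).trans
      ((le_stochasticTerm hσ hL.le hΔ.le hlam hA).trans stochasticTerm_le_errorBound)
  · rw [← le_div_iff₀ hp, mul_div_assoc, mul_assoc, mul_div_assoc] at htight
    refine (div_mul_le_of_sqrt_le_mul hL hΔ.le hm htight K).trans
      (le_trans (le_of_eq ?_)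
        ((le_clippingBiasTerm hL.le hΔ.le hlam.le).trans clippingBiasTerm_le_errorBound))
    field_simp
  · exact (div_mul_le_of_sqrt_le_mul hL hΔ.le hm htight K).trans
      ((le_dpTerm hL.le hΔ.le hA).trans dpTerm_le_errorBound)

theorem four_mul_div_le_mul_errorBound {c : ℝ} (hc : 0 < c) (hσ : 0 < σ) (hL : 0 < L) (hΔ : 0 < Δ)
    (hlam : 0 < lam) (hK : 1 ≤ K) (hA : 0 ≤ Real.log (K / β)) :
    4 * Δ / (c * stepsizeMin d K α σ σw L Δ lam β * K)
      ≤ 4 / c * errorBound d K α σ σw L Δ lam β := by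
  rw [mul_assoc c, mul_div_mul_comm]
  gcongr
  exact div_stepsizeMin_le_errorBound hσ hL hΔ hlam hK hA

theorem half_le_log_of_optimizationTerm_lt (hL : 0 < L) (hΔ : 0 < Δ) (hK : 1 ≤ K) (hβ : 0 < β)
    (hβ_le : β ≤ 1) (h : optimizationTerm K L Δ lam < L * Δ / 2) :
    1 / 2 ≤ Real.log (K / β) := by
  have hK_gt : (2 : ℝ) < K := (div_lt_div_iff_of_pos_left (mul_pos hL hΔ) (by positivity)
    two_pos).1 (div_le_optimizationTerm.trans_lt h)
  have hKβ : (2 : ℝ) ≤ K / β := hK_gt.le.trans (le_div_self (by positivity) hβ hβ_le)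
  linarith [Real.log_le_log two_pos hKβ, Real.log_two_gt_d9]

theorem three_mul_le_of_clippingBiasTerm_lt (hσ : 0 < σ) (hL : 0 < L) (hΔ : 0 < Δ)
    (hlam : 0 < lam) (h : clippingBiasTerm α σ L Δ lam < L * Δ / 2) :
    3 * (L * √(Δ / L)) ≤ lam := by
  rw [mul_sqrt_div hL]
  by_contra! hlarge
  have hp : 0 < lam ^ (α - 1) := by positivity
  have hζ : √(L * Δ) / 2 ≤ zeta L Δ lam := le_trans (by linarith) (le_max_right _ _)
  refine h.not_ge ?_
  calc L * Δ / 2 = √(L * Δ) * (√(L * Δ) / 2) := by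
        rw [← mul_div_assoc, Real.mul_self_sqrt (by positivity)]
    _ ≤ √(L * Δ) * zeta L Δ lam := by gcongr
    _ ≤ √(L * Δ) * (noiseLevel α σ L Δ lam * biasFactor α σ L Δ lam / lam ^ (α - 1)) := by
        gcongr
        rw [le_div_iff₀' hp]
        exact zeta_le_mul_biasFactor hσ hlam
    _ ≤ clippingBiasTerm α σ L Δ lam := le_clippingBiasTerm hL.le hΔ.le hlam.le

end ErrorBound

section Tuning

variable {d K : ℕ} {α σ σw L Δ lam β : ℝ}

theorem sq_mul_le_of_mul_sqrt_le {a X r : ℝ} (ha : 0 ≤ a) (hX : 0 ≤ X) (h : a * √X ≤ r) :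
    a ^ 2 * X ≤ r ^ 2 := by
  rw [← Real.sq_sqrt hX, ← mul_pow]
  gcongr

theorem sq_mul_sq_mul_div_rpow_le {m X r : ℝ} (hm : 0 ≤ m) (hlam : 0 < lam) (hX : 0 ≤ X)
    (h : m * (lam ^ (1 - α / 2) * √X) ≤ r) : m ^ 2 * lam ^ 2 * (X / lam ^ α) ≤ r ^ 2 := by
  have hpow : (lam ^ (1 - α / 2)) ^ 2 = lam ^ 2 / lam ^ α := by
    rw [← Real.rpow_mul_natCast hlam.le, ← Real.rpow_natCast, ← Real.rpow_sub hlam]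
    congr 1
    push_cast
    ring
  rw [← mul_assoc] at h
  calc m ^ 2 * lam ^ 2 * (X / lam ^ α) = (m * lam ^ (1 - α / 2)) ^ 2 * X := by
        rw [mul_pow, hpow]
        ring
    _ ≤ r ^ 2 := sq_mul_le_of_mul_sqrt_le (by positivity) hX h

theorem mul_div_rpow_mul_le {m B S X r : ℝ} (hm : 0 ≤ m) (hlam : 0 < lam) (hS : 0 ≤ S)
    (hX : 0 ≤ X) (hB : 1 / 4 ≤ B) (h : m * (X * S * B) ≤ r * lam ^ (α - 1)) :
    m * X * (S / lam ^ α) * lam ≤ 4 * r := by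
  have hquarter : m * (X * S * (1 / 4)) ≤ r * lam ^ (α - 1) := le_trans (by gcongr) h
  rw [Real.rpow_sub_one hlam.ne', ← mul_div_assoc r, le_div_iff₀ hlam] at hquarter
  rw [← mul_div_assoc, div_mul_eq_mul_div, div_le_iff₀ (by positivity)]
  linarith

theorem tunedStepsize_mul {K A s r c m : ℝ} (hc : 0 < c) (hc_le : c ≤ 1 / 600) (hK : 1 ≤ K)
    (hA : 1 / 2 ≤ A) (hs : 0 < s) (hL : 0 < L) (hr : 0 < r) (hlam : 0 < lam) (hm : 0 < m)
    (hsmooth : m * L ≤ 1) (hvar : m ^ 2 * lam ^ 2 * (K * A * s) ≤ r ^ 2)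
    (hbias : m * K * s * lam ≤ 4 * r) (hlevel : (80 * c) ^ 2 * A ≤ K * s)
    (hnoise : (m * σw) ^ 2 * (d * K * A) ≤ r ^ 2) :
    TunedStepsize d K A s L r lam σw (c * m) where
  one_le_K := hK
  half_le_A := hA
  s_pos := hs
  L_pos := hL
  r_pos := hr
  lam_pos := hlam
  γ_pos := by positivity
  smoothness := by
    calc c * m * L = c * (m * L) := mul_assoc _ _ _
      _ ≤ 1 / 600 * 1 := by gcongr
      _ = 1 / 600 := mul_one _
  variance := by
    calc (c * m) ^ 2 * lam ^ 2 * K * A * s = c ^ 2 * (m ^ 2 * lam ^ 2 * (K * A * s)) := by ring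
      _ ≤ (1 / 600) ^ 2 * r ^ 2 := by gcongr
      _ = r ^ 2 / 360000 := by ring
  bias := by
    calc c * m * K * s * lam = c * (m * K * s * lam) := by ring
      _ ≤ 1 / 600 * (4 * r) := by gcongr
      _ = r / 150 := by ring
  range := by
    have : 0 < A := one_half_pos.trans_le hA
    refine (sq_le_sq₀ (by positivity) (by positivity)).1 ?_
    calc (c * m * lam * A) ^ 2 = m ^ 2 * lam ^ 2 * A * ((80 * c) ^ 2 * A) / 6400 := by ring
      _ ≤ m ^ 2 * lam ^ 2 * A * (K * s) / 6400 := by gcongr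
      _ = m ^ 2 * lam ^ 2 * (K * A * s) / 6400 := by ring
      _ ≤ r ^ 2 / 6400 := by gcongr
      _ = (r / 80) ^ 2 := by ring
  noise := by
    calc (c * m) ^ 2 * σw ^ 2 * d * K * A = c ^ 2 * ((m * σw) ^ 2 * (d * K * A)) := by ring
      _ ≤ (1 / 600) ^ 2 * r ^ 2 := by gcongr
      _ = r ^ 2 / 360000 := by ring

theorem tunedStepsize_mul_stepsizeMin {c : ℝ} (hc : 0 < c) (hc_le : c ≤ 1 / 600)
    (hlevel : (80 * c) ^ 2 * (lam ^ α * Real.log (K / β)) ≤ K * noiseLevel α σ L Δ lam)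
    (hα : α ≠ 0) (hσ : 0 < σ) (hσw : 0 ≤ σw) (hL : 0 < L) (hΔ : 0 < Δ) (hlam : 0 < lam)
    (hK : 1 ≤ K) (hA : 1 / 2 ≤ Real.log (K / β)) :
    TunedStepsize d K (Real.log (K / β)) (noiseLevel α σ L Δ lam / lam ^ α) L √(Δ / L) lam σw
      (c * stepsizeMin d K α σ σw L Δ lam β) := by
  have hm := stepsizeMin_pos (d := d) (K := K) (α := α) (σ := σ) (σw := σw) (β := β) hL hΔ hlam
  obtain ⟨hsmooth, hvar, hbias, hnoise⟩ := (le_stepsizeMin_iff hL hΔ hlam hm.le).1 le_rfl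
  have hS := noiseLevel_pos (α := α) (L := L) (Δ := Δ) (lam := lam) hσ
  have hB := quarter_le_biasFactor (L := L) (Δ := Δ) hσ hα hlam
  have : 0 < Real.log (K / β) := one_half_pos.trans_le hA
  have hp : 0 < lam ^ α := by positivity
  refine tunedStepsize_mul hc hc_le (by exact_mod_cast hK) hA (by positivity) hL (by positivity)
    hlam hm ((le_div_iff₀ hL).1 hsmooth) ?_
    (mul_div_rpow_mul_le hm.le hlam hS.le (by positivity) hB hbias) ?_
    (sq_mul_le_of_mul_sqrt_le (by positivity) (by positivity) (by rwa [mul_assoc]))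
  · rw [← mul_div_assoc]
    exact sq_mul_sq_mul_div_rpow_le hm.le hlam (by positivity) hvar
  · rwa [← mul_div_assoc, le_div_iff₀ hp, mul_assoc, mul_comm _ (lam ^ α)]

end Tuning

section Convergence

variable {d K : ℕ} {Ξ Ω : Type*} [MeasurableSpace Ξ] [MeasurableSpace Ω] {D : Measure Ξ}
  [IsProbabilityMeasure D] {F : Ξ → EuclideanSpace ℝ (Fin d) → ℝ} {P : Measure Ω}
  [IsProbabilityMeasure P] {ξ : ℕ → Ω → Ξ} {w : ℕ → Ω → EuclideanSpace ℝ (Fin d)}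
  {x₀ : EuclideanSpace ℝ (Fin d)} {α σ σw L Δ lam β fstar c : ℝ}

theorem ofReal_one_sub_le_one_sub_exp_neg_log (hK : 1 ≤ K) (hβ : 0 < β) :
    ENNReal.ofReal (1 - β) ≤ 1 - ENNReal.ofReal (Real.exp (-Real.log (K / β))) := by
  have hK' : (1 : ℝ) ≤ K := by exact_mod_cast hK
  rw [ENNReal.ofReal_sub _ hβ.le, ENNReal.ofReal_one, Real.exp_neg, Real.exp_log (by positivity),
    inv_div]
  gcongr
  exact div_le_self hβ.le hK'

theorem sq_mul_le_of_le_div_sqrt {M X Y : ℝ} (hM : 0 < M) (hc : 0 ≤ c) (hc_le : c ≤ 1 / (80 * √M))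
    (hY : 0 ≤ Y) (hX : X ≤ M * Y) : (80 * c) ^ 2 * X ≤ Y := by
  have hcM : (80 * c) ^ 2 * M ≤ 1 ^ 2 := by
    refine sq_mul_le_of_mul_sqrt_le (by positivity) hM.le ?_
    rw [le_div_iff₀ (by positivity)] at hc_le
    linarith
  calc (80 * c) ^ 2 * X ≤ (80 * c) ^ 2 * M * Y := by
        rw [mul_assoc]
        gcongr
    _ ≤ Y := mul_le_of_le_one_left hY (by simpa only [one_pow] using hcM)

theorem mainTheorem6_general (hF : StochasticObjective D F)
    (hle : ∀ x ∈ region (expectedLoss D F) fstar L Δ, fstar ≤ expectedLoss D F x)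
    (hf : SmoothOn (expectedLoss D F) L (region (expectedLoss D F) fstar L Δ))
    (hO : HeavyTailedOracleOn D F α σ (region (expectedLoss D F) fstar L Δ))
    (hx₀ : expectedLoss D F x₀ - fstar ≤ Δ) (hS : IndependentSteps P D σw ξ w)
    (hlevel : (80 * c) ^ 2 * (lam ^ α * Real.log (K / β)) ≤ K * noiseLevel α σ L Δ lam)
    (hc : 0 < c) (hc_le : c ≤ 1 / 600) (hK : 1 ≤ K) (hβ : 0 < β) (hβ_le : β ≤ 1) (hα : 1 ≤ α)
    (hα_le : α ≤ 2) (hσ : 0 < σ) (hσw : 0 ≤ σw) (hL : 0 < L) (hΔ : 0 < Δ) (hlam : 0 < lam) :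
    ENNReal.ofReal (1 - β) ≤ P {ω | ⨅ t : Fin (K + 1), ‖∇ (expectedLoss D F)
        (iterate F (c * stepsizeMin d K α σ σw L Δ lam β) lam x₀ (fun k => ξ k ω)
          (fun k => w k ω) t)‖ ^ 2
      ≤ 4 / c * errorBound d K α σ σw L Δ lam β} := by
  have hsub := SublevelSmooth.of_region hL hΔ.le hf hle
  rw [← mul_sqrt_div_sq hL hΔ.le] at hx₀
  rcases le_or_gt (L * Δ / 2) (errorBound d K α σ σw L Δ lam β) with htrivial | hsmall
  · refine (ENNReal.ofReal_le_one.2 (sub_le_self 1 hβ.le)).trans ?_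
    rw [← measure_univ (μ := P), ← Set.ofPred_true]
    refine measure_mono (Set.ofPred_subset_ofPred.2 fun ω _ =>
      (hsub.iInf_norm_gradient_sq_le hL (by positivity) hx₀).trans ?_)
    calc 2 * L * (L * √(Δ / L) ^ 2) = 4 * (L * Δ / 2) := by rw [mul_sqrt_div_sq hL hΔ.le]; ring
      _ ≤ 4 / c * errorBound d K α σ σw L Δ lam β := by
        gcongr
        exact le_div_self zero_le_four hc (hc_le.trans (by norm_num))
  · have hA : 1 / 2 ≤ Real.log (K / β) := half_le_log_of_optimizationTerm_lt hL hΔ hK hβ hβ_le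
      (optimizationTerm_le_errorBound.trans_lt hsmall)
    have hlam_ge : 3 * (L * √(Δ / L)) ≤ lam := three_mul_le_of_clippingBiasTerm_lt hσ hL hΔ hlam
      (clippingBiasTerm_le_errorBound.trans_lt hsmall)
    have htuned := tunedStepsize_mul_stepsizeMin (d := d) hc hc_le hlevel
      (one_pos.trans_le hα).ne' hσ hσw hL hΔ hlam hK hA
    refine (ofReal_one_sub_le_one_sub_exp_neg_log hK hβ).trans
      ((htuned.one_sub_le_measure_iInf_norm_gradient_sq_le hsub hF hO hS hα hα_le
        (rpow_le_noiseLevel_div_mul hlam) hlam_ge hx₀).trans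
          (measure_mono (Set.ofPred_subset_ofPred.2 fun ω hω => hω.trans ?_)))
    rw [mul_sqrt_div_sq hL hΔ.le]
    exact four_mul_div_le_mul_errorBound hc hσ hL hΔ hlam hK (one_half_pos.le.trans hA)

end Convergence

end DPClippedSGD

theorem mainTheorem6 (M : ℝ) (hM : 0 < M) :
    ∃ c₀ : ℝ, 0 < c₀ ∧ ∀ c : ℝ, 0 < c → c ≤ c₀ → ∃ C : ℝ, 0 < C ∧
      ∀ (d : ℕ) (Ξ : Type*) [MeasurableSpace Ξ] (D : Measure Ξ) [IsProbabilityMeasure D]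
        (F : Ξ → EuclideanSpace ℝ (Fin d) → ℝ)
        (Ω : Type*) [MeasurableSpace Ω] (P : Measure Ω) [IsProbabilityMeasure P]
        (ξ : ℕ → Ω → Ξ) (w : ℕ → Ω → EuclideanSpace ℝ (Fin d))
        (x₀ : EuclideanSpace ℝ (Fin d)) (K : ℕ) (α σ σw L Δ lam β fstar γ : ℝ),
        1 ≤ K → 0 < β → β ≤ 1 → 1 < α → α ≤ 2 → 0 < σ → 0 ≤ σw → 0 < L → 0 < Δ → 0 < lam →
        DPClippedSGD.StochasticObjective D F →
        IsGLB (DPClippedSGD.expectedLoss D F ''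
          DPClippedSGD.region (DPClippedSGD.expectedLoss D F) fstar L Δ) fstar →
        DPClippedSGD.SmoothOn (DPClippedSGD.expectedLoss D F) L
          (DPClippedSGD.region (DPClippedSGD.expectedLoss D F) fstar L Δ) →
        DPClippedSGD.HeavyTailedOracleOn D F α σ
          (DPClippedSGD.region (DPClippedSGD.expectedLoss D F) fstar L Δ) →
        DPClippedSGD.expectedLoss D F x₀ - fstar ≤ Δ →
        DPClippedSGD.FreshSamples P D σw ξ w →
        lam ^ α * Real.log (K / β) ≤ M * K * DPClippedSGD.noiseLevel α σ L Δ lam →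
        γ = c * DPClippedSGD.stepsizeMin d K α σ σw L Δ lam β →
        ENNReal.ofReal (1 - β) ≤
          P {ω | (⨅ t : Fin (K + 1),
              ‖∇ (DPClippedSGD.expectedLoss D F)
                (DPClippedSGD.iterate F γ lam x₀ (fun k => ξ k ω) (fun k => w k ω) t)‖ ^ 2)
            ≤ C * max (max (DPClippedSGD.optimizationTerm K L Δ lam)
                  (DPClippedSGD.stochasticTerm K α σ L Δ lam β))
                (max (DPClippedSGD.clippingBiasTerm α σ L Δ lam)
                  (DPClippedSGD.dpTerm d K σw L Δ lam β))} := by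
  refine ⟨min (1 / 600) (1 / (80 * √M)), by positivity, fun c hc hc_le =>
    ⟨4 / c, by positivity, ?_⟩⟩
  rintro d Ξ _ D _ F Ω _ P _ ξ w x₀ K α σ σw L Δ lam β fstar _ hK hβ hβ_le hα hα_le hσ hσw hL hΔ
    hlam hF hglb hf hO hx₀ hfresh hlevel rfl
  have hS := DPClippedSGD.noiseLevel_pos (α := α) (L := L) (Δ := Δ) (lam := lam) hσ
  exact DPClippedSGD.mainTheorem6_general hF (fun x hx => hglb.1 ⟨x, hx, rfl⟩) hf hO hx₀
    hfresh.independentSteps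
    (DPClippedSGD.sq_mul_le_of_le_div_sqrt hM hc.le (hc_le.trans (min_le_right _ _))
      (by positivity) (hlevel.trans_eq (mul_assoc _ _ _)))
    hc (hc_le.trans (min_le_left _ _)) hK hβ hβ_le hα.le hα_le hσ hσw hL hΔ hlam
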